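/- Let $\mathbb{T}^d=(\mathbb{R}/2\pi\mathbb{Z})^d$, let $H\in\mathcal{C}^\infty(\mathbb{R}^d;\mathbb{R})$, let $S_h^t=e^{-i\frac th H(hD_x)}$ on $L^2(\mathbb{T}^d)$, and let $\tau_h>0$, $\varepsilon_h>0$ ($h>0$) satisfy, as $h\to0^+$, $$\tau_h\to+\infty,\qquad h\tau_h\to0,\qquad \varepsilon_h\to0,\qquad \frac{h\tau_h}{\varepsilon_h}\to0 .$$ Let $\rho\in\mathcal{S}(\mathbb{R}^d)$ with $\|\rho\|_{L^2(\mathbb{R}^d)}=1$ and with compactly supported Fourier transform, and let $x_0,\xi_0,\eta_0\in\mathbb{R}^d$. Let $\Lambda_{\xi_0}=\{k\in\mathbb{Z}^d: k\cdot dH(\xi_0)=0\}$ and let $\langle\Lambda_{\xi_0}\rangle\subseteq\mathbb{R}^d$ be its real linear span. Suppose that $d^2H(\xi_0)$ is definite (positive or negative) and that $\eta_0\in\langle\Lambda_{\xi_0}\rangle$. Define $$u_h(x)=\sum_{k\in\mathbb{Z}^d}\tilde v_h(x+2\pi k),\qquad \tilde v_h(x)=\frac{1}{\varepsilon_h^{d/2}}\,\rho\!\left(\frac{x-x_0}{\varepsilon_h}\right)e^{\frac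 ih\xi_0\cdot x}\,e^{\frac{i}{h\tau_h}\eta_0\cdot x}.$$ For $(x,\xi)\in\mathbb{R}^d\times\mathbb{R}^d$ let $\mu_{(x,\xi)}$ be the uniform orbit measure, i.e. the probability measure on $T^*\mathbb{T}^d=\mathbb{T}^d\times\mathbb{R}^d$ such that $$\int_{T^*\mathbb{T}^d}a\,d\mu_{(x,\xi)}=\lim_{T\to\infty}\frac1T\int_0^T a\big(x+s\,dH(\xi),\xi\big)\,ds\qquad\text{for all }a\in\mathcal{C}_c(T^*\mathbb{T}^d).$$ Then, as $h\to0^+$, the Wigner distributions $w_h(t,\cdot)$ of $S_h^{\tau_h t}u_h$, defined by $\langle w_h(t,\cdot),a\rangle=\langle S_h^{\tau_ht}u_h,\operatorname{Op}_h(a)S_h^{\tau_ht}u_h\rangle_{L^2(\mathbb{T}^d)}$ with $\operatorname{Op}_h$ the semiclassical Weyl quantization, converge weakly-$*$ in $L^\infty(\mathbb{R};\mathcal{D}'(T^*\mathbb{T}^d))$ to $\mu(t,\cdot)=\mu_{(x_0+t\,d^2H(\xi_0)\eta_0,\ \xi_0)}$; that is, $$\int_{\mathbb{R}}\varphi(t)\,\langle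 w_h(t,\cdot),a\rangle\,dt\longrightarrow\int_{\mathbb{R}}\varphi(t)\int_{T^*\mathbb{T}^d}a\,d\mu_{(x_0+t\,d^2H(\xi_0)\eta_0,\,\xi_0)}\,dt$$ for every $\varphi\in L^1(\mathbb{R})$ and every $a\in\mathcal{C}_c^\infty(T^*\mathbb{T}^d)$. -/

import Mathlib

open MeasureTheory Filter Topology Asymptotics
open scoped ContDiff FourierTransform SchwartzMap ENNReal

noncomputable section

namespace TorusSemiclassical

instance factTwoPiPos : Fact (0 < 2 * Real.pi) := ⟨Real.two_pi_pos⟩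

/-- The Euclidean space `ℝ^d`, identified with its dual through the canonical basis. -/
abbrev Space (d : ℕ) : Type := EuclideanSpace ℝ (Fin d)

/-- The torus `𝕋^d = (ℝ / 2πℤ)^d`, with its Lebesgue measure of total mass `(2π)^d`. -/
abbrev Torus (d : ℕ) : Type := Fin d → AddCircle (2 * Real.pi)

/-- The cotangent bundle `T^*𝕋^d = 𝕋^d × (ℝ^d)^*`. -/
abbrev Phase (d : ℕ) : Type := Torus d × Space d

/-- The projection `ℝ^d → 𝕋^d`. -/
def toTorus {d : ℕ} (x : Space d) : Torus d := fun i => (x i : AddCircle (2 * Real.pi))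

/-- The representative of a point of the torus in the fundamental cell `[0, 2π)^d`. -/
def cellRep {d : ℕ} (x : Torus d) : Space d :=
  WithLp.toLp 2 (fun i => (AddCircle.equivIco (2 * Real.pi) 0 (x i) : ℝ))

/-- An integer vector, seen in `ℝ^d`. -/
def intVec {d : ℕ} (k : Fin d → ℤ) : Space d := WithLp.toLp 2 (fun i => (k i : ℝ))

/-! ### Hamiltonian -/

/-- The Hessian `d²H(ξ)` as a linear map: `⟪hessian H ξ η, ζ⟫ = D²H(ξ)(η, ζ)`. -/
def hessian {d : ℕ} (H : Space d → ℝ) (ξ : Space d) : Space d →L[ℝ] Space d :=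
  fderiv ℝ (gradient H) ξ

/-- `d²H(ξ)` is definite, positive or negative. -/
def HessianDefinite {d : ℕ} (H : Space d → ℝ) (ξ : Space d) : Prop :=
  (∀ ζ : Space d, ζ ≠ 0 → 0 < inner ℝ (hessian H ξ ζ) ζ) ∨
  (∀ ζ : Space d, ζ ≠ 0 → inner ℝ (hessian H ξ ζ) ζ < 0)

/-- The module `Λ_ξ = {k ∈ ℤ^d : k · dH(ξ) = 0}`. -/
def resonantModule {d : ℕ} (H : Space d → ℝ) (ξ : Space d) : Set (Fin d → ℤ) :=
  {k | inner ℝ (intVec k) (gradient H ξ) = 0}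

/-- The real linear span `⟨Λ_ξ⟩` of `Λ_ξ` in `ℝ^d`. -/
def resonantSpan {d : ℕ} (H : Space d → ℝ) (ξ : Space d) : Submodule ℝ (Space d) :=
  Submodule.span ℝ (intVec '' resonantModule H ξ)

/-! ### The Schrödinger propagator -/

/-- The normalised exponential `x ↦ (2π)^{-d/2} e^{i k · x}` on the torus. -/
def torusMode {d : ℕ} (k : Fin d → ℤ) : C(Torus d, ℂ) where
  toFun x := (((2 * Real.pi) ^ ((d : ℝ) / 2))⁻¹ : ℝ) * ∏ i, fourier (k i) (x i)
  continuous_toFun := by fun_prop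

/-- Fourier coefficients `∫_{𝕋^d} u(x) (2π)^{-d/2} e^{-i k · x} dx`. -/
def fourierCoeffTorus {d : ℕ} (u : Torus d → ℂ) (k : Fin d → ℤ) : ℂ :=
  ∫ x, u x * (starRingEnd ℂ) (torusMode k x)

/-- The propagator `S_h^s = e^{-i (s/h) H(hD_x)}`, that is, the Fourier multiplier
`e^{-i (s/h) H(hk)}` on `L²(𝕋^d)`. The series is a series in the Hilbert space `L²(𝕋^d)`
with orthogonal terms, and converges there for every square-integrable `u`. -/
def propagator {d : ℕ} (H : Space d → ℝ) (h s : ℝ) (u : Torus d → ℂ) :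
    Lp ℂ 2 (volume : Measure (Torus d)) :=
  ∑' k : Fin d → ℤ,
    (Complex.exp (-Complex.I * ((s / h * H (h • intVec k) : ℝ) : ℂ)) * fourierCoeffTorus u k) •
      ContinuousMap.toLp (E := ℂ) 2 (volume : Measure (Torus d)) ℂ (torusMode k)

/-! ### Weyl quantization and Wigner distributions -/

/-- The class `C_c^∞(T^*𝕋^d)`; smoothness is that of the lift to `ℝ^d × ℝ^d`. -/
def IsTestSymbol {d : ℕ} (a : Phase d → ℂ) : Prop :=
  ContDiff ℝ ∞ (fun p : Space d × Space d => a (toTorus p.1, p.2)) ∧ HasCompactSupport a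

/-- The Schwartz kernel on `ℝ^d × ℝ^d` of the semiclassical Weyl quantization of `a`:
`(2πh)^{-d} ∫ a((x+y)/2, ξ) e^{i ξ · (x-y) / h} dξ`. -/
def weylKernel {d : ℕ} (h : ℝ) (a : Phase d → ℂ) (x y : Space d) : ℂ :=
  (((2 * Real.pi * h) ^ d)⁻¹ : ℝ) *
    ∫ ξ : Space d, a (toTorus ((2⁻¹ : ℝ) • (x + y)), ξ) *
      Complex.exp (Complex.I * ((inner ℝ ξ (x - y) / h : ℝ) : ℂ))

/-- The Weyl operator `Op_h(a)` on the torus: the Weyl operator of `ℝ^d` acting on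
`2πℤ^d`-periodic functions, the resulting periodic function being seen on the torus. -/
def weylOp {d : ℕ} (h : ℝ) (a : Phase d → ℂ) (u : Torus d → ℂ) : Torus d → ℂ :=
  fun x => ∫ y : Space d, weylKernel h a (cellRep x) y * u (toTorus y)

/-- The Wigner distribution `⟨w_u^h, a⟩ = ⟨u, Op_h(a) u⟩_{L²(𝕋^d)}`. -/
def wigner {d : ℕ} (h : ℝ) (u : Torus d → ℂ) (a : Phase d → ℂ) : ℂ :=
  ∫ x, (starRingEnd ℂ) (u x) * weylOp h a u x

/-- Weak-* convergence in `L^∞(ℝ; 𝓓'(T^*𝕋^d))`, as `h → 0⁺`, of a family `w h t` of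
time-dependent distributions to a time-dependent measure `μ t`. -/
def TendstoWeakStar {d : ℕ} (w : ℝ → ℝ → (Phase d → ℂ) → ℂ) (μ : ℝ → Measure (Phase d)) :
    Prop :=
  ∀ a : Phase d → ℂ, IsTestSymbol a →
    (∀ h : ℝ, 0 < h → MemLp (fun t => w h t a) ∞ volume) ∧
    MemLp (fun t => ∫ z, a z ∂(μ t)) ∞ volume ∧
    ∀ φ : ℝ → ℂ, Integrable φ →
      Tendsto (fun h => ∫ t, φ t * w h t a) (𝓝[>] (0 : ℝ))
        (𝓝 (∫ t, φ t * ∫ z, a z ∂(μ t)))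

/-- `μ` is the uniform measure on the orbit issued from `(x, ξ)` of the Hamiltonian flow
`(x, ξ) ↦ (x + s dH(ξ), ξ)`. These time averages determine a unique probability measure. -/
def IsUniformOrbitMeasure {d : ℕ} (H : Space d → ℝ) (x ξ : Space d) (μ : Measure (Phase d)) :
    Prop :=
  IsProbabilityMeasure μ ∧
  ∀ a : Phase d → ℂ, Continuous a → HasCompactSupport a →
    Tendsto (fun T : ℝ => ((1 / T : ℝ) : ℂ) *
        ∫ s in (0 : ℝ)..T, a (toTorus (x + s • gradient H ξ), ξ)) atTop
      (𝓝 (∫ z, a z ∂μ))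

/-! ### Modulated wave packets -/

/-- The function `ε^{-d/2} ρ((x - x₀)/ε) e^{i ξ₀ · x / h} e^{i η₀ · x / (hτ)}` on `ℝ^d`. -/
def modulatedPacket {d : ℕ} (ρ : Space d → ℂ) (x₀ ξ₀ η₀ : Space d) (h τ ε : ℝ) (x : Space d) :
    ℂ :=
  ((ε ^ ((d : ℝ) / 2))⁻¹ : ℝ) * ρ (ε⁻¹ • (x - x₀)) *
    Complex.exp (Complex.I * ((inner ℝ ξ₀ x / h : ℝ) : ℂ)) *
    Complex.exp (Complex.I * ((inner ℝ η₀ x / (h * τ) : ℝ) : ℂ))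

/-- The periodization `x ↦ ∑_{k ∈ ℤ^d} v(x + 2πk)`, as a function on the torus. -/
def periodize {d : ℕ} (v : Space d → ℂ) : Torus d → ℂ :=
  fun x => ∑' k : Fin d → ℤ, v (cellRep x + (2 * Real.pi) • intVec k)

end TorusSemiclassical

end

open TorusSemiclassical

/-!
The argument takes place on the Fourier side. A smooth compactly supported symbol has an expansion
`a(x, ξ) = ∑ₘ aₘ(ξ) e^{i m · x}` with `∑ₘ sup |aₘ| < ∞`. To get it without derivative estimates on
the torus, `a` is localised near one cell by a smooth partition of unity made of lattice translates;
the localised symbol is a Schwartz function on `ℝ^d × ℝ^d`, and the decay of its Fourier transform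
gives all the bounds (`IsTestSymbol.exists_symbolExpansion`). The Weyl operator then acts on
exponentials by `e_k ↦ ∑ₘ aₘ(h (k + m / 2)) e_{k + m}`
(`SymbolExpansion.hasSum_weylOp`).

Since the Fourier transform of the profile `ρ` has compact support, the periodized packet is a
trigonometric polynomial with frequencies `k` satisfying `h k = ξ₀ + η₀ / τ + O(h / ε)`, and
`h / ε = o(1 / τ)`. For each `m` its Wigner distribution at time `τ t` involves the beats between
the modes `k + m` and `k`, of phase `t (τ / h) (H(h (k + m)) - H(h k))`. By a first order expansion
of `∇H` at `ξ₀` this is `t (τ m · ∇H(ξ₀) + m · d²H(ξ₀) η₀ + o(1))`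
(`tendsto_differenceQuotient`). If `m · ∇H(ξ₀) ≠ 0` the phase is rapidly oscillating and, after
integration against `φ ∈ L¹`, the contribution vanishes by the Riemann-Lebesgue lemma; otherwise it
converges. The sum over `k` is a Riemann sum for `∫ |ρ̂|² = 1`; it is written as an integral over
`ℝ^d` of a function of the integer part of the variable (`sum_eq_integral_floorVec`), so that
dominated convergence applies pointwise in the rescaled frequency, and the sum over `m` passes to
the limit by Tannery's theorem (`tendsto_tsum_integral_beatTerm`). The limit is
`∑ₘ aₘ(ξ₀) e^{i m · (x₀ + t d²H(ξ₀) η₀)}` over the `m` orthogonal to `∇H(ξ₀)`.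

This is the average of `a` over the orbit closure: the uniform orbit measure is the image of the
Haar probability measure of the closure of the one-parameter subgroup `s ↦ s ∇H(ξ₀)` of the torus,
by Weyl equidistribution (`tendsto_average_torus`), and a character of the torus has mean `1` or
`0` on that subgroup according to whether its frequency is orthogonal to `∇H(ξ₀)` or not
(`SymbolExpansion.hasSum_integral_orbitMeasure`).
-/

namespace TorusSemiclassical

variable {d : ℕ}

/-! ### Lattice cells and unfolding -/

@[simp] lemma intVec_apply (k : Fin d → ℤ) (i : Fin d) : intVec k i = (k i : ℝ) := rfl

@[simp] lemma toTorus_apply (x : Space d) (i : Fin d) :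
    toTorus x i = (x i : AddCircle (2 * Real.pi)) := rfl

lemma intVec_add (k l : Fin d → ℤ) : intVec (k + l) = intVec k + intVec l := by
  ext i; simp

lemma intVec_neg (k : Fin d → ℤ) : intVec (-k) = -intVec k := by
  ext i; simp

/-- The componentwise integer part of a vector. -/
noncomputable def floorVec (x : Space d) : Fin d → ℤ := fun i => ⌊x i⌋

lemma measurable_floorVec : Measurable (floorVec : Space d → Fin d → ℤ) := by
  unfold floorVec
  refine measurable_pi_lambda _ fun i => ?_
  exact Int.measurable_floor.comp (by fun_prop)

/-- For `T > 0`, the half-open cube of side `T` with lowest corner `T k`. -/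
def latticeCell (T : ℝ) (k : Fin d → ℤ) : Set (Space d) := {x | floorVec (T⁻¹ • x) = k}

lemma measurableSet_latticeCell (T : ℝ) (k : Fin d → ℤ) : MeasurableSet (latticeCell T k) := by
  have : Measurable fun x : Space d => floorVec (T⁻¹ • x) :=
    measurable_floorVec.comp (by fun_prop)
  exact this (measurableSet_singleton k)

lemma iUnion_latticeCell (T : ℝ) : ⋃ k, latticeCell (d := d) T k = Set.univ := by
  ext x; simp [latticeCell]

lemma pairwise_disjoint_latticeCell (T : ℝ) :
    Pairwise (Function.onFun Disjoint (latticeCell (d := d) T)) := by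
  intro k l hkl
  refine Set.disjoint_left.2 fun x hx hx' => hkl ?_
  exact hx.symm.trans hx'

lemma mem_latticeCell_iff {T : ℝ} (hT : 0 < T) {k : Fin d → ℤ} {x : Space d} :
    x ∈ latticeCell T k ↔ ∀ i, x i ∈ Set.Ico (T * k i) (T * k i + T) := by
  simp only [latticeCell, Set.mem_ofPred_eq, funext_iff, floorVec, Int.floor_eq_iff, Set.mem_Ico]
  refine forall_congr' fun i => ?_
  simp only [PiLp.smul_apply, smul_eq_mul]
  rw [inv_mul_eq_div, le_div_iff₀ hT, div_lt_iff₀ hT]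
  constructor <;> rintro ⟨h1, h2⟩ <;> constructor <;> nlinarith

lemma preimage_add_latticeCell {T : ℝ} (hT : 0 < T) (k : Fin d → ℤ) :
    (fun x : Space d => x + T • intVec k) ⁻¹' latticeCell T k = latticeCell T 0 := by
  ext x
  simp only [Set.mem_preimage, mem_latticeCell_iff hT]
  refine forall_congr' fun i => ?_
  simp only [PiLp.add_apply, PiLp.smul_apply, intVec_apply, smul_eq_mul, Pi.zero_apply,
    Int.cast_zero, mul_zero, zero_add, Set.mem_Ico]
  constructor <;> rintro ⟨h1, h2⟩ <;> constructor <;> linarith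

lemma norm_sub_floorVec_le (x : Space d) : ‖x - intVec (floorVec x)‖ ≤ √d := by
  rw [EuclideanSpace.norm_eq]
  refine Real.sqrt_le_sqrt ?_
  calc ∑ i, ‖(x - intVec (floorVec x)) i‖ ^ 2 ≤ ∑ _i : Fin d, (1 : ℝ) := by
        refine Finset.sum_le_sum fun i _ => ?_
        have h0 : (x - intVec (floorVec x)) i = Int.fract (x i) := rfl
        rw [h0, Real.norm_eq_abs, sq_abs]
        nlinarith [Int.fract_nonneg (x i), Int.fract_lt_one (x i)]
    _ = d := by simp

lemma volume_latticeCell_one (k : Fin d → ℤ) : volume (latticeCell (1 : ℝ) k) = 1 := by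
  have h := (PiLp.volume_preserving_toLp (Fin d)).measure_preimage
    (measurableSet_latticeCell (1 : ℝ) k).nullMeasurableSet
  rw [← h]
  have : (WithLp.toLp 2 : (Fin d → ℝ) → Space d) ⁻¹' latticeCell 1 k
      = Set.univ.pi fun i => Set.Ico (k i : ℝ) (k i + 1) := by
    ext x
    simp only [Set.mem_preimage, mem_latticeCell_iff one_pos, one_mul, Set.mem_univ_pi]
  rw [this, Real.volume_pi_Ico]
  simp

section Unfolding

variable {E : Type*} [NormedAddCommGroup E] [NormedSpace ℝ E]

lemma setIntegral_latticeCell {T : ℝ} (hT : 0 < T) (f : Space d → E) (k : Fin d → ℤ) :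
    ∫ x in latticeCell T k, f x = ∫ x in latticeCell T 0, f (x + T • intVec k) := by
  have h := (measurePreserving_add_right (volume : Measure (Space d))
    (T • intVec k)).setIntegral_preimage_emb
    (measurableEmbedding_addRight (T • intVec k)) f (latticeCell T k)
  rw [preimage_add_latticeCell hT] at h
  exact h.symm

lemma integrableOn_latticeCell_add {F : Type*} [NormedAddCommGroup F] {f : Space d → F}
    (hf : Integrable f) (T : ℝ) (k : Fin d → ℤ) :
    IntegrableOn (fun x => f (x + T • intVec k)) (latticeCell T 0) :=
  (hf.comp_add_right (T • intVec k)).integrableOn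

lemma hasSum_setIntegral_latticeCell {T : ℝ} (hT : 0 < T) {f : Space d → E} (hf : Integrable f) :
    HasSum (fun k : Fin d → ℤ => ∫ x in latticeCell T 0, f (x + T • intVec k)) (∫ x, f x) := by
  have h := hasSum_integral_iUnion (μ := (volume : Measure (Space d))) (f := f)
    (measurableSet_latticeCell (d := d) T) (pairwise_disjoint_latticeCell T)
    hf.integrableOn
  rw [iUnion_latticeCell, Measure.restrict_univ] at h
  exact h.congr_fun fun k => (setIntegral_latticeCell hT f k).symm

/-- Unfolding: the integral of a periodization over a cell is the integral over `ℝ^d`. -/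
lemma setIntegral_latticeCell_tsum [CompleteSpace E] {T : ℝ} (hT : 0 < T) {f : Space d → E}
    (hf : Integrable f) :
    ∫ x in latticeCell T 0, ∑' k : Fin d → ℤ, f (x + T • intVec k) = ∫ x, f x := by
  rw [← (hasSum_setIntegral_latticeCell hT hf).tsum_eq]
  exact (integral_tsum_of_summable_integral_norm
    (fun k => integrableOn_latticeCell_add hf T k)
    (hasSum_setIntegral_latticeCell hT hf.norm).summable).symm

lemma aestronglyMeasurable_tsum_latticeCell {T : ℝ} {f : Space d → ℂ} (hf : Integrable f) :
    AEStronglyMeasurable (fun x => ∑' k : Fin d → ℤ, f (x + T • intVec k))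
      (volume.restrict (latticeCell T 0)) := by
  have hm : ∀ k, AEMeasurable (fun x => f (x + T • intVec k))
      (volume.restrict (latticeCell T 0)) :=
    fun k => (integrableOn_latticeCell_add hf T k).aestronglyMeasurable.aemeasurable
  exact (AEMeasurable.tsum hm).aestronglyMeasurable

end Unfolding

/-- A finitely supported sum over `ℤ^d` as an integral over `ℝ^d`, for a lattice of mesh `δ`
placed at an arbitrary offset. -/
lemma sum_eq_integral_floorVec {δ : ℝ} (hδ : 0 < δ) (s : Space d) (F : Finset (Fin d → ℤ))
    (f : (Fin d → ℤ) → ℂ) (hf : ∀ k ∉ F, f k = 0) :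
    (δ ^ d : ℝ) * ∑ k ∈ F, f k = ∫ x : Space d, f (floorVec (δ⁻¹ • x + s)) := by
  have h1 : ∫ y : Space d, f (floorVec y) = ∑ k ∈ F, f k := by
    have hrep : ∀ y : Space d, f (floorVec y)
        = ∑ k ∈ F, (latticeCell (1 : ℝ) k).indicator (fun _ => f k) y := by
      intro y
      simp only [Set.indicator_apply, latticeCell, inv_one, one_smul, Set.mem_ofPred_eq]
      rw [Finset.sum_ite_eq]
      split_ifs with h
      · rfl
      · exact hf _ h
    simp_rw [hrep]
    rw [integral_finsetSum]
    · refine Finset.sum_congr rfl fun k _ => ?_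
      rw [integral_indicator (measurableSet_latticeCell _ _)]
      simp [Measure.real, volume_latticeCell_one]
    · intro k _
      rw [integrable_indicator_iff (measurableSet_latticeCell _ _)]
      refine integrableOn_const ?_
      simp [volume_latticeCell_one]
  have h2 := Measure.integral_comp_smul (volume : Measure (Space d))
    (fun y => f (floorVec (y + s))) δ⁻¹
  rw [h2, integral_add_right_eq_self (fun y => f (floorVec y)) s, h1]
  simp [abs_of_pos hδ]

/-! ### Summation over the lattice -/

lemma summable_one_add_norm_intVec :
    Summable fun k : Fin d → ℤ => (1 + ‖intVec k‖) ^ (-((d : ℝ) + 1)) := by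
  have hint : Integrable (fun x : Space d => (1 + ‖x‖) ^ (-((d : ℝ) + 1))) :=
    integrable_one_add_norm (by simp)
  have hs := (hasSum_setIntegral_latticeCell one_pos hint).summable
  refine Summable.of_nonneg_of_le (fun k => by positivity) (fun k => ?_)
    (hs.mul_left ((1 + √d) ^ ((d : ℝ) + 1)))
  have hvol : volume.real (latticeCell (d := d) (1 : ℝ) 0) = 1 := by
    simp [Measure.real, volume_latticeCell_one]
  have hle : ∫ x in latticeCell (d := d) (1 : ℝ) 0, (1 + √d) ^ (-((d : ℝ) + 1)) *
      (1 + ‖intVec k‖) ^ (-((d : ℝ) + 1))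
      ≤ ∫ x in latticeCell (1 : ℝ) 0, (1 + ‖x + (1 : ℝ) • intVec k‖) ^ (-((d : ℝ) + 1)) := by
    refine setIntegral_mono_on ?_ ?_ (measurableSet_latticeCell _ _) fun x hx => ?_
    · exact integrableOn_const (by simp [volume_latticeCell_one])
    · exact integrableOn_latticeCell_add hint 1 k
    · have h0 : floorVec x = 0 := by simpa [latticeCell] using hx
      have h1 := norm_sub_floorVec_le x
      have h00 : intVec (0 : Fin d → ℤ) = 0 := by ext i; simp
      rw [h0, h00, sub_zero] at h1
      rw [← Real.mul_rpow (by positivity) (by positivity)]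
      refine Real.rpow_le_rpow_of_nonpos (by positivity) ?_
        (by linarith [Nat.cast_nonneg (α := ℝ) d])
      have := norm_add_le x ((1 : ℝ) • intVec k)
      rw [one_smul] at *
      nlinarith [norm_nonneg (intVec k), Real.sqrt_nonneg d]
  rw [setIntegral_const, hvol, one_smul] at hle
  calc (1 + ‖intVec k‖) ^ (-((d : ℝ) + 1))
      = (1 + √d) ^ ((d : ℝ) + 1) *
        ((1 + √d) ^ (-((d : ℝ) + 1)) * (1 + ‖intVec k‖) ^ (-((d : ℝ) + 1))) := by
        rw [← mul_assoc, ← Real.rpow_add (by positivity)]; simp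
    _ ≤ _ := by gcongr

/-! ### The torus as a quotient -/

lemma toTorus_add (x y : Space d) : toTorus (x + y) = toTorus x + toTorus y := by
  ext i; simp

lemma toTorus_period (k : Fin d → ℤ) : toTorus ((2 * Real.pi) • intVec k) = 0 := by
  funext i
  simp only [toTorus_apply, PiLp.smul_apply, intVec_apply, smul_eq_mul, Pi.zero_apply]
  rw [show 2 * Real.pi * (k i : ℝ) = k i • (2 * Real.pi) by rw [zsmul_eq_mul, mul_comm],
    AddCircle.coe_zsmul, AddCircle.coe_period, smul_zero]

lemma toTorus_add_period (x : Space d) (k : Fin d → ℤ) :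
    toTorus (x + (2 * Real.pi) • intVec k) = toTorus x := by
  rw [toTorus_add, toTorus_period, add_zero]

lemma toTorus_cellRep (x : Torus d) : toTorus (cellRep x) = x := by
  funext i
  exact (AddCircle.equivIco (2 * Real.pi) 0).symm_apply_apply (x i)

lemma cellRep_toTorus {x : Space d} (hx : x ∈ latticeCell (2 * Real.pi) 0) :
    cellRep (toTorus x) = x := by
  rw [mem_latticeCell_iff Real.two_pi_pos] at hx
  ext i
  have := hx i
  simp only [Pi.zero_apply, Int.cast_zero, mul_zero] at this
  exact congrArg Subtype.val
    ((AddCircle.equivIco (2 * Real.pi) 0).apply_symm_apply ⟨x i, this⟩)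

lemma continuous_toTorus : Continuous (toTorus : Space d → Torus d) := by
  unfold toTorus
  refine continuous_pi fun i => ?_
  exact (AddCircle.continuous_mk' _).comp (by fun_prop)

lemma isOpenQuotientMap_toTorus : IsOpenQuotientMap (toTorus : Space d → Torus d) := by
  have h : IsOpenQuotientMap (Pi.map fun _ : Fin d => ((↑) : ℝ → AddCircle (2 * Real.pi))) :=
    IsOpenQuotientMap.piMap fun i => QuotientAddGroup.isOpenQuotientMap_mk
  exact h.comp (PiLp.homeomorph 2 (fun _ : Fin d => ℝ)).isOpenQuotientMap

lemma measurable_cellRep : Measurable (cellRep : Torus d → Space d) := by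
  have : Measurable fun x : Torus d => fun i =>
      ((AddCircle.equivIco (2 * Real.pi) 0 (x i) : Set.Ico (0:ℝ) (0 + 2 * Real.pi)) : ℝ) := by
    refine measurable_pi_lambda _ fun i => ?_
    exact measurable_subtype_coe.comp
      ((AddCircle.measurableEquivIco (2 * Real.pi) 0).measurable.comp (measurable_pi_apply i))
  exact (MeasurableEquiv.toLp 2 (Fin d → ℝ)).measurable.comp this

lemma measurePreserving_toTorus :
    MeasurePreserving (toTorus : Space d → Torus d)
      (volume.restrict (latticeCell (2 * Real.pi) 0)) volume := by
  have h1 : MeasurePreserving (fun (x : Fin d → ℝ) (i : Fin d) => (x i : AddCircle (2 * Real.pi)))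
      (Measure.pi fun _ => volume.restrict (Set.Ico (0 : ℝ) (0 + 2 * Real.pi)))
      (Measure.pi fun _ => volume) := by
    refine measurePreserving_pi _ _ fun i => ?_
    rw [Measure.restrict_congr_set Ico_ae_eq_Ioc]
    exact AddCircle.measurePreserving_mk _ 0
  rw [← Measure.restrict_pi_pi] at h1
  have h2 : MeasurePreserving (WithLp.ofLp : Space d → Fin d → ℝ)
      (volume.restrict (WithLp.ofLp ⁻¹' (Set.univ.pi fun _ => Set.Ico (0 : ℝ) (0 + 2 * Real.pi))))
      (volume.restrict (Set.univ.pi fun _ => Set.Ico (0 : ℝ) (0 + 2 * Real.pi))) :=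
    (PiLp.volume_preserving_ofLp (Fin d)).restrict_preimage
      (MeasurableSet.univ_pi fun _ => measurableSet_Ico)
  have h3 : latticeCell (d := d) (2 * Real.pi) 0
      = WithLp.ofLp ⁻¹' (Set.univ.pi fun _ => Set.Ico (0 : ℝ) (0 + 2 * Real.pi)) := by
    ext x
    rw [mem_latticeCell_iff Real.two_pi_pos]
    simp only [Set.mem_preimage, Set.mem_univ_pi, Pi.zero_apply, Int.cast_zero, mul_zero]
  rw [h3]
  exact h1.comp h2

lemma measurePreserving_cellRep :
    MeasurePreserving (cellRep : Torus d → Space d) volume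
      (volume.restrict (latticeCell (2 * Real.pi) 0)) := by
  refine ⟨measurable_cellRep, ?_⟩
  rw [← measurePreserving_toTorus.map_eq,
    Measure.map_map measurable_cellRep continuous_toTorus.measurable]
  have : cellRep ∘ toTorus =ᵐ[volume.restrict (latticeCell (d := d) (2 * Real.pi) 0)] id := by
    filter_upwards [ae_restrict_mem (measurableSet_latticeCell _ _)] with x hx
    exact cellRep_toTorus hx
  rw [Measure.map_congr this, Measure.map_id]

lemma quasiMeasurePreserving_toTorus :
    Measure.QuasiMeasurePreserving (toTorus : Space d → Torus d) volume volume := by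
  refine ⟨continuous_toTorus.measurable, ?_⟩
  refine Measure.AbsolutelyContinuous.mk fun s hs h0 => ?_
  have hs' := continuous_toTorus.measurable hs
  rw [Measure.map_apply continuous_toTorus.measurable hs]
  have h1 : volume (toTorus ⁻¹' s ∩ latticeCell (d := d) (2 * Real.pi) 0) = 0 := by
    rw [← Measure.restrict_apply hs',
      measurePreserving_toTorus.measure_preimage hs.nullMeasurableSet, h0]
  have h2 : ∀ k, volume (toTorus ⁻¹' s ∩ latticeCell (d := d) (2 * Real.pi) k) = 0 := by
    intro k
    rw [← measure_preimage_add_right volume ((2 * Real.pi) • intVec k), Set.preimage_inter,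
      preimage_add_latticeCell Real.two_pi_pos]
    convert! h1 using 3
    ext x
    simp [toTorus_add_period]
  rw [← Set.inter_univ (toTorus ⁻¹' s), ← iUnion_latticeCell (2 * Real.pi), Set.inter_iUnion]
  exact measure_iUnion_null h2

/-! ### Characters of the torus -/

/-- The character `x ↦ e^{i k · x}` of the torus. -/
noncomputable def torusChar (k : Fin d → ℤ) : C(Torus d, ℂ) where
  toFun x := ∏ i, fourier (k i) (x i)
  continuous_toFun := by fun_prop

lemma torusChar_toTorus (k : Fin d → ℤ) (x : Space d) :
    torusChar k (toTorus x) = Complex.exp (Complex.I * ((inner ℝ (intVec k) x : ℝ) : ℂ)) := by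
  have hpi : (Real.pi : ℂ) ≠ 0 := by exact_mod_cast Real.pi_ne_zero
  simp only [torusChar, ContinuousMap.coe_mk, toTorus_apply, fourier_coe_apply]
  rw [← Complex.exp_sum, PiLp.inner_apply]
  congr 1
  push_cast
  rw [Finset.mul_sum]
  refine Finset.sum_congr rfl fun i _ => ?_
  simp
  field_simp

lemma torusChar_add (k l : Fin d → ℤ) (x : Torus d) :
    torusChar (k + l) x = torusChar k x * torusChar l x := by
  simp only [torusChar, ContinuousMap.coe_mk, Pi.add_apply, fourier_add, Finset.prod_mul_distrib]

lemma torusChar_neg (k : Fin d → ℤ) (x : Torus d) :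
    torusChar (-k) x = (starRingEnd ℂ) (torusChar k x) := by
  simp only [torusChar, ContinuousMap.coe_mk, Pi.neg_apply, fourier_neg, map_prod]

@[simp] lemma torusChar_zero (x : Torus d) : torusChar (0 : Fin d → ℤ) x = 1 := by
  simp [torusChar]

lemma torusChar_apply_add (k : Fin d → ℤ) (x y : Torus d) :
    torusChar k (x + y) = torusChar k x * torusChar k y := by
  simp [torusChar, fourier_apply, smul_add, AddCircle.toCircle_add, Finset.prod_mul_distrib]

@[simp] lemma norm_torusChar (k : Fin d → ℤ) (x : Torus d) : ‖torusChar k x‖ = 1 := by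
  simp only [torusChar, ContinuousMap.coe_mk, fourier_apply, norm_prod, Circle.norm_coe,
    Finset.prod_const_one]

lemma torusMode_eq (k : Fin d → ℤ) (x : Torus d) :
    torusMode k x = (((2 * Real.pi) ^ ((d : ℝ) / 2))⁻¹ : ℝ) * torusChar k x := rfl

lemma integral_torusChar (k : Fin d → ℤ) :
    ∫ x, torusChar k x = if k = 0 then (((2 * Real.pi) ^ d : ℝ) : ℂ) else 0 := by
  split_ifs with hk
  · subst hk
    simp only [torusChar_zero, integral_const, Measure.real, volume_pi, Measure.pi_univ,
      AddCircle.measure_univ, Finset.prod_const, Finset.card_univ, Fintype.card_fin,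
      ENNReal.toReal_pow, ENNReal.toReal_ofReal Real.two_pi_pos.le]
    simp
  · -- translating by a point where the character is not `1` multiplies the integral
    obtain ⟨i, hi⟩ := Function.ne_iff.1 hk
    have hki : (k i : ℝ) ≠ 0 := by exact_mod_cast hi
    let y : Space d := EuclideanSpace.single i (Real.pi / k i)
    have hy : torusChar k (toTorus y) = -1 := by
      rw [torusChar_toTorus]
      have : inner ℝ (intVec k) y = Real.pi := by
        simp only [y, EuclideanSpace.inner_single_right]
        simp [hki]
      rw [this, mul_comm, Complex.exp_pi_mul_I]
    have h := integral_add_right_eq_self (μ := (volume : Measure (Torus d)))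
      (fun x => torusChar k x) (toTorus y)
    simp only [torusChar_apply_add, hy, mul_neg, mul_one, integral_neg] at h
    have h2 : (2 : ℂ) * ∫ x, torusChar k x = 0 := by linear_combination -h
    simpa using h2

lemma integral_conj_torusMode_mul (j k : Fin d → ℤ) :
    ∫ x, (starRingEnd ℂ) (torusMode j x) * torusMode k x = if j = k then 1 else 0 := by
  have h : ∀ x : Torus d, (starRingEnd ℂ) (torusMode j x) * torusMode k x
      = ((((2 * Real.pi) ^ d)⁻¹ : ℝ) : ℂ) * torusChar (k - j) x := by
    intro x
    have h2 : ((2 * Real.pi) ^ ((d : ℝ) / 2)) * ((2 * Real.pi) ^ ((d : ℝ) / 2))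
        = (2 * Real.pi) ^ d := by
      rw [← Real.rpow_add Real.two_pi_pos, add_halves, Real.rpow_natCast]
    rw [torusMode_eq, torusMode_eq, map_mul, Complex.conj_ofReal, ← torusChar_neg, ← h2,
      sub_eq_add_neg, torusChar_add, mul_inv]
    push_cast
    ring
  simp_rw [h]
  rw [integral_const_mul, integral_torusChar]
  have hpi : ((2 * Real.pi) ^ d : ℝ) ≠ 0 := by positivity
  by_cases hjk : j = k
  · simp only [hjk, sub_self, if_true]
    rw [← Complex.ofReal_mul, inv_mul_cancel₀ hpi, Complex.ofReal_one]
  · rw [if_neg, if_neg hjk, mul_zero]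
    exact fun h => hjk (sub_eq_zero.1 h).symm

/-! ### A smooth partition of unity of `ℝ^d` by lattice translates -/

/-- A smooth function on `ℝ`, supported in `[-1, 1]`, whose integer translates sum to `1`. -/
noncomputable def unitBump (t : ℝ) : ℝ :=
  Real.smoothTransition (t + 1) - Real.smoothTransition t

lemma contDiff_unitBump : ContDiff ℝ ∞ unitBump := by
  have h : ContDiff ℝ ∞ Real.smoothTransition := Real.smoothTransition.contDiff
  exact (h.comp (contDiff_id.add contDiff_const)).sub h

lemma unitBump_eq_zero {t : ℝ} (ht : 1 ≤ |t|) : unitBump t = 0 := by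
  unfold unitBump
  rcases le_abs.1 ht with h | h
  · rw [Real.smoothTransition.one_of_one_le h, Real.smoothTransition.one_of_one_le (by linarith),
      sub_self]
  · rw [Real.smoothTransition.zero_of_nonpos (by linarith),
      Real.smoothTransition.zero_of_nonpos (by linarith), sub_self]

lemma unitBump_add_unitBump {t : ℝ} (h0 : 0 ≤ t) (h1 : t < 1) :
    unitBump (t + (-1 : ℤ)) + unitBump (t + (0 : ℤ)) = 1 := by
  unfold unitBump
  push_cast
  rw [Real.smoothTransition.zero_of_nonpos (x := t + -1) (by linarith), add_zero,
    Real.smoothTransition.one_of_one_le (x := t + 1) (by linarith)]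
  simp

/-- The product bump function `∏ i, unitBump (x i)` on `ℝ^d`. -/
noncomputable def cubeBump (x : Space d) : ℝ := ∏ i, unitBump (x i)

lemma contDiff_cubeBump : ContDiff ℝ ∞ (cubeBump : Space d → ℝ) := by
  unfold cubeBump
  refine contDiff_prod fun i _ => ?_
  exact contDiff_unitBump.comp (contDiff_piLp_apply (p := 2))

lemma norm_le_of_cubeBump_ne_zero {x : Space d} (hx : cubeBump x ≠ 0) : ‖x‖ ≤ √d := by
  rw [EuclideanSpace.norm_eq]
  refine Real.sqrt_le_sqrt ?_
  calc ∑ i, ‖x i‖ ^ 2 ≤ ∑ _i : Fin d, (1 : ℝ) := by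
        refine Finset.sum_le_sum fun i _ => ?_
        have hi : |x i| < 1 := by
          by_contra! h
          exact hx (Finset.prod_eq_zero (Finset.mem_univ i) (unitBump_eq_zero h))
        rw [Real.norm_eq_abs]
        nlinarith [abs_nonneg (x i)]
    _ = d := by simp

lemma tsum_cubeBump {x : Space d} (hx : x ∈ latticeCell 1 0) :
    ∑' k : Fin d → ℤ, cubeBump (x + intVec k) = 1 := by
  classical
  rw [mem_latticeCell_iff one_pos] at hx
  simp only [Pi.zero_apply, Int.cast_zero, mul_zero, zero_add, Set.mem_Ico] at hx
  rw [tsum_eq_sum (s := Fintype.piFinset fun _ => ({-1, 0} : Finset ℤ))]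
  · simp only [cubeBump, PiLp.add_apply, intVec_apply]
    rw [← Finset.prod_univ_sum (fun _ => ({-1, 0} : Finset ℤ))
      (fun i (j : ℤ) => unitBump (x i + j))]
    refine Finset.prod_eq_one fun i _ => ?_
    rw [Finset.sum_pair (by norm_num)]
    exact unitBump_add_unitBump (hx i).1 (hx i).2
  · intro k hk
    simp only [Fintype.mem_piFinset, not_forall, Finset.mem_insert, Finset.mem_singleton,
      not_or] at hk
    obtain ⟨i, hi1, hi2⟩ := hk
    refine Finset.prod_eq_zero (Finset.mem_univ i) (unitBump_eq_zero ?_)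
    simp only [PiLp.add_apply, intVec_apply]
    have hki : k i ≤ -2 ∨ 1 ≤ k i := by omega
    rw [le_abs]
    rcases hki with h | h
    · right
      have : (k i : ℝ) ≤ -2 := by exact_mod_cast h
      linarith [(hx i).2]
    · left
      have : (1 : ℝ) ≤ k i := by exact_mod_cast h
      linarith [(hx i).1]

/-! ### Test symbols -/

section TestSymbol

variable {a : Phase d → ℂ}

lemma IsTestSymbol.continuous (ha : IsTestSymbol a) : Continuous a := by
  have h : IsOpenQuotientMap (Prod.map (toTorus : Space d → Torus d) (id : Space d → Space d)) :=
    isOpenQuotientMap_toTorus.prodMap .id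
  exact h.isQuotientMap.continuous_iff.2 ha.1.continuous

lemma IsTestSymbol.exists_radius (ha : IsTestSymbol a) :
    ∃ R : ℝ, ∀ x ξ, a (x, ξ) ≠ 0 → ‖ξ‖ ≤ R := by
  obtain ⟨R, hR⟩ := ((ha.2.image continuous_snd).isBounded).exists_norm_le
  exact ⟨R, fun x ξ h => hR ξ ⟨(x, ξ), subset_tsupport _ h, rfl⟩⟩

lemma IsTestSymbol.hasCompactSupport_snd (ha : IsTestSymbol a) (x : Torus d) :
    HasCompactSupport fun ξ => a (x, ξ) := by
  obtain ⟨R, hR⟩ := ha.exists_radius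
  refine HasCompactSupport.intro (isCompact_closedBall (0 : Space d) R) fun ξ hξ => ?_
  by_contra h
  exact hξ (by simpa using hR x ξ h)

lemma IsTestSymbol.contDiff_snd (ha : IsTestSymbol a) (x : Torus d) :
    ContDiff ℝ ∞ fun ξ => a (x, ξ) := by
  have := ha.1.comp (contDiff_prodMk_right (cellRep x))
  simpa [Function.comp_def, toTorus_cellRep] using this

lemma IsTestSymbol.fourierInv_fourier (ha : IsTestSymbol a) (x : Torus d) :
    𝓕⁻ (𝓕 fun ξ => a (x, ξ)) = fun ξ => a (x, ξ) := by
  let f : 𝓢(Space d, ℂ) := (ha.hasCompactSupport_snd x).toSchwartzMap (ha.contDiff_snd x)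
  have hf : (f : Space d → ℂ) = fun ξ => a (x, ξ) := rfl
  rw [← hf]
  refine f.continuous.fourierInv_fourier_eq f.integrable ?_
  rw [← SchwartzMap.fourier_coe]
  exact (𝓕 f).integrable

lemma IsTestSymbol.continuous_fourier (ha : IsTestSymbol a) (w : Space d) :
    Continuous fun x => 𝓕 (fun ξ => a (x, ξ)) w := by
  obtain ⟨R, hR⟩ := ha.exists_radius
  obtain ⟨C, hC⟩ := ha.2.exists_bound_of_continuous ha.continuous
  simp only [Real.fourier_eq']
  have hcont := ha.continuous
  refine continuous_of_dominated (bound := (Metric.closedBall (0 : Space d) R).indicator fun _ => C)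
    (fun x => ?_) (fun x => .of_forall fun ξ => ?_) ?_ (.of_forall fun ξ => ?_)
  · refine Continuous.aestronglyMeasurable ?_
    fun_prop
  · rw [norm_smul, Complex.norm_exp_ofReal_mul_I, one_mul]
    by_cases h : ξ ∈ Metric.closedBall (0 : Space d) R
    · rw [Set.indicator_of_mem h]; exact hC _
    · rw [Set.indicator_of_notMem h]
      have : a (x, ξ) = 0 := by
        by_contra h0
        exact h (by simpa using hR x ξ h0)
      simp [this]
  · rw [integrable_indicator_iff measurableSet_closedBall]
    exact integrableOn_const (by exact measure_closedBall_lt_top.ne)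
  · fun_prop

/-- The symbol localised to a neighbourhood of one lattice cell in the position variable (with the
lattice rescaled to `ℤ^d`), seen as a Schwartz function of both variables. -/
noncomputable def IsTestSymbol.localized (ha : IsTestSymbol a) :
    𝓢(WithLp 2 (Space d × Space d), ℂ) :=
  HasCompactSupport.toSchwartzMap
    (f := fun p => (cubeBump p.fst : ℂ) * a (toTorus ((2 * Real.pi) • p.fst), p.snd))
    (by
      obtain ⟨R, hR⟩ := ha.exists_radius
      have hK : IsCompact ((WithLp.toLp 2 : Space d × Space d → _) ''
          (Metric.closedBall (0 : Space d) √d ×ˢ Metric.closedBall (0 : Space d) R)) :=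
        ((isCompact_closedBall _ _).prod (isCompact_closedBall _ _)).image
          (WithLp.prodContinuousLinearEquiv 2 ℝ (Space d) (Space d)).symm.continuous
      refine HasCompactSupport.intro hK fun p hp => ?_
      by_contra h
      rw [mul_eq_zero, not_or, Complex.ofReal_eq_zero] at h
      refine hp ⟨p.ofLp, ⟨?_, ?_⟩, rfl⟩
      · simpa using norm_le_of_cubeBump_ne_zero h.1
      · simpa using hR _ _ h.2)
    (by
      have hL := (WithLp.prodContinuousLinearEquiv 2 ℝ (Space d) (Space d)).contDiff (n := ∞)
      have h1 : ContDiff ℝ ∞ fun p : WithLp 2 (Space d × Space d) => p.fst :=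
        _root_.contDiff_fst.comp hL
      have h2 : ContDiff ℝ ∞ fun p : WithLp 2 (Space d × Space d) => p.snd :=
        _root_.contDiff_snd.comp hL
      refine ContDiff.mul ?_ ?_
      · exact Complex.ofRealCLM.contDiff.comp (contDiff_cubeBump.comp h1)
      · exact ha.1.comp ((h1.const_smul (2 * Real.pi)).prodMk h2))

lemma IsTestSymbol.localized_apply (ha : IsTestSymbol a) (x ξ : Space d) :
    ha.localized (WithLp.toLp 2 (x, ξ)) = (cubeBump x : ℂ) * a (toTorus ((2 * Real.pi) • x), ξ) :=
  rfl

/-- The homeomorphism between the unit torus and the torus of period `2π`. -/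
noncomputable def unitTorusHomeo : UnitAddTorus (Fin d) ≃ₜ Torus d :=
  Homeomorph.piCongrRight fun _ =>
    AddCircle.homeomorphAddCircle 1 (2 * Real.pi) one_ne_zero Real.two_pi_pos.ne'

lemma unitTorusHomeo_coe (x : Fin d → ℝ) :
    unitTorusHomeo (fun i => (x i : UnitAddCircle)) =
      toTorus ((2 * Real.pi) • WithLp.toLp 2 x) := by
  funext i
  change AddCircle.homeomorphAddCircle 1 (2 * Real.pi) one_ne_zero Real.two_pi_pos.ne' (x i) = _
  rw [AddCircle.homeomorphAddCircle_apply_mk]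
  simp [mul_comm]

lemma mFourier_eq_torusChar (k : Fin d → ℤ) (θ : UnitAddTorus (Fin d)) :
    UnitAddTorus.mFourier k θ = torusChar k (unitTorusHomeo θ) := by
  have hpi : (Real.pi : ℂ) ≠ 0 := by exact_mod_cast Real.pi_ne_zero
  simp only [UnitAddTorus.mFourier, torusChar, ContinuousMap.coe_mk]
  refine Finset.prod_congr rfl fun i _ => ?_
  obtain ⟨t, ht⟩ := QuotientAddGroup.mk_surjective (θ i)
  have h1 : θ i = ((t : ℝ) : UnitAddCircle) := ht.symm
  have h2 : unitTorusHomeo θ i = ((t * (1⁻¹ * (2 * Real.pi)) : ℝ) : AddCircle (2 * Real.pi)) := by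
    change AddCircle.homeomorphAddCircle 1 (2 * Real.pi) one_ne_zero Real.two_pi_pos.ne' (θ i) = _
    rw [h1, AddCircle.homeomorphAddCircle_apply_mk]
  rw [h1, h2, fourier_coe_apply, fourier_coe_apply]
  congr 1
  push_cast
  field_simp

lemma mFourierCoeff_eq_setIntegral_latticeCell (f : Torus d → ℂ) (k : Fin d → ℤ) :
    UnitAddTorus.mFourierCoeff (fun θ => f (unitTorusHomeo θ)) k =
      ∫ x in latticeCell 1 0, torusChar (-k) (toTorus ((2 * Real.pi) • x)) *
        f (toTorus ((2 * Real.pi) • x)) := by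
  rw [UnitAddTorus.mFourierCoeff_eq_integral _ _ 0]
  have hset : {x : Fin d → ℝ | ∀ i, x i ∈ Set.Ioc ((0 : Fin d → ℝ) i) ((0 : Fin d → ℝ) i + 1)}
      =ᵐ[volume] (WithLp.toLp 2 : (Fin d → ℝ) → Space d) ⁻¹' latticeCell 1 0 := by
    have h1 : {x : Fin d → ℝ | ∀ i, x i ∈ Set.Ioc ((0 : Fin d → ℝ) i) ((0 : Fin d → ℝ) i + 1)}
        = Set.univ.pi fun i => Set.Ioc ((0 : Fin d → ℝ) i) ((fun _ => 1 : Fin d → ℝ) i) := by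
      ext x; simp
    have h2 : (WithLp.toLp 2 : (Fin d → ℝ) → Space d) ⁻¹' latticeCell 1 0
        = Set.univ.pi fun i => Set.Ico ((0 : Fin d → ℝ) i) ((fun _ => 1 : Fin d → ℝ) i) := by
      ext x
      simp only [Set.mem_preimage, mem_latticeCell_iff one_pos]
      simp
    rw [h1, h2]
    exact Measure.univ_pi_Ioc_ae_eq_Icc.trans Measure.univ_pi_Ico_ae_eq_Icc.symm
  rw [setIntegral_congr_set hset,
    ← (PiLp.volume_preserving_toLp (Fin d)).setIntegral_preimage_emb
      (MeasurableEquiv.toLp 2 (Fin d → ℝ)).measurableEmbedding]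
  refine setIntegral_congr_fun
    ((MeasurableEquiv.toLp 2 (Fin d → ℝ)).measurable (measurableSet_latticeCell 1 0)) fun x _ => ?_
  simp only [smul_eq_mul, mFourier_eq_torusChar, unitTorusHomeo_coe]

/-- The Fourier coefficients in position of the Fourier transform in momentum of a symbol are
values of the Fourier transform of the localised symbol. -/
lemma IsTestSymbol.mFourierCoeff_fourier (ha : IsTestSymbol a) (k : Fin d → ℤ) (w : Space d) :
    UnitAddTorus.mFourierCoeff (fun θ => 𝓕 (fun ξ => a (unitTorusHomeo θ, ξ)) w) k =
      𝓕 ha.localized (WithLp.toLp 2 (intVec k, w)) := by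
  rw [mFourierCoeff_eq_setIntegral_latticeCell (fun x => 𝓕 (fun ξ => a (x, ξ)) w)]
  set P : Space d → ℂ := fun x => torusChar (-k) (toTorus ((2 * Real.pi) • x)) *
        𝓕 (fun ξ => a (toTorus ((2 * Real.pi) • x), ξ)) w with hP
  have hPper : ∀ x l, P (x + intVec l) = P x := by
    intro x l
    simp only [hP, smul_add, toTorus_add_period]
  have hPcont : Continuous P := by
    have h0 : Continuous fun x : Space d => toTorus ((2 * Real.pi) • x) :=
      continuous_toTorus.comp (continuous_const_smul _)
    exact ((torusChar (-k)).continuous.comp h0).mul ((ha.continuous_fourier w).comp h0)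
  have hint : Integrable fun x => (cubeBump x : ℂ) * P x := by
    refine Continuous.integrable_of_hasCompactSupport
      ((Complex.continuous_ofReal.comp contDiff_cubeBump.continuous).mul hPcont) ?_
    refine HasCompactSupport.intro (isCompact_closedBall (0 : Space d) √d) fun x hx => ?_
    by_contra h
    refine hx ?_
    have := norm_le_of_cubeBump_ne_zero (x := x) fun h0 => h (by simp [h0])
    simpa using this
  have hunfold := setIntegral_latticeCell_tsum one_pos hint
  have hcell : ∫ x in latticeCell 1 0, P x =
      ∫ x in latticeCell 1 0, ∑' l : Fin d → ℤ,
        (cubeBump (x + (1 : ℝ) • intVec l) : ℂ) * P (x + (1 : ℝ) • intVec l) := by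
    refine setIntegral_congr_fun (measurableSet_latticeCell 1 0) fun x hx => ?_
    simp only [one_smul, hPper]
    rw [tsum_mul_right, ← Complex.ofReal_tsum, tsum_cubeBump hx, Complex.ofReal_one, one_mul]
  rw [hcell, hunfold, SchwartzMap.fourier_coe, Real.fourier_eq']
  rw [← (WithLp.volume_preserving_toLp (Space d) (Space d)).integral_comp
    (MeasurableEquiv.toLp 2 (Space d × Space d)).measurableEmbedding]
  rw [Measure.volume_eq_prod, integral_prod]
  · refine integral_congr_ae (.of_forall fun x => ?_)
    simp only [hP]
    rw [Real.fourier_eq', ← mul_assoc, ← integral_const_mul]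
    refine integral_congr_ae (.of_forall fun ξ => ?_)
    simp only [ha.localized_apply, smul_eq_mul, WithLp.prod_inner_apply]
    rw [torusChar_toTorus, intVec_neg, inner_neg_left, inner_smul_right]
    have : Complex.exp (((-2 * Real.pi * (inner ℝ x (intVec k) + inner ℝ ξ w) : ℝ) : ℂ) * Complex.I)
        = Complex.exp (Complex.I * ((-(2 * Real.pi * inner ℝ (intVec k) x) : ℝ) : ℂ)) *
          Complex.exp (((-2 * Real.pi * inner ℝ ξ w : ℝ) : ℂ) * Complex.I) := by
      rw [← Complex.exp_add, real_inner_comm x (intVec k)]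
      congr 1
      push_cast
      ring
    rw [this]
    ring
  · have h := (Real.fourierIntegral_convergent_iff (μ := volume)
      (WithLp.toLp 2 (intVec k, w))).2 ha.localized.integrable
    have h2 := ((WithLp.volume_preserving_toLp (Space d) (Space d)).integrable_comp_emb
      (MeasurableEquiv.toLp 2 (Space d × Space d)).measurableEmbedding).2 h
    refine h2.congr (.of_forall fun p => ?_)
    simp only [Function.comp_apply, Real.fourierChar_apply, Circle.smul_def]
    congr 3
    push_cast
    ring

end TestSymbol

/-- The expansion of a symbol in Fourier modes: `mode m` is the Fourier transform in the momentum
variable of the `m`-th Fourier coefficient in the position variable, with a bound which is summable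
in the mode and integrable in the dual momentum variable. Fourier inversion in the momentum variable
is part of the data. -/
structure SymbolExpansion (a : Phase d → ℂ) where
  mode : (Fin d → ℤ) → Space d → ℂ
  modeBound : (Fin d → ℤ) → ℝ
  profile : Space d → ℝ
  continuous_mode : ∀ m, Continuous (mode m)
  summable_modeBound : Summable modeBound
  integrable_profile : Integrable profile
  modeBound_nonneg : ∀ m, 0 ≤ modeBound m
  profile_nonneg : ∀ w, 0 ≤ profile w
  norm_mode_le : ∀ m w, ‖mode m w‖ ≤ modeBound m * profile w
  hasSum_mode : ∀ x w, HasSum (fun m => mode m w * torusChar m x) (𝓕 (fun ξ => a (x, ξ)) w)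
  fourierInv_fourier : ∀ x, 𝓕⁻ (𝓕 fun ξ => a (x, ξ)) = fun ξ => a (x, ξ)

theorem IsTestSymbol.exists_symbolExpansion {a : Phase d → ℂ} (ha : IsTestSymbol a) :
    Nonempty (SymbolExpansion a) := by
  set f : 𝓢(WithLp 2 (Space d × Space d), ℂ) := 𝓕 ha.localized with hf
  obtain ⟨C, hC⟩ : ∃ C : ℝ, ∀ p, (1 + ‖p‖) ^ (2 * (d + 1)) * ‖f p‖ ≤ C :=
    ⟨_, fun p => by
      simpa using SchwartzMap.one_add_le_sup_seminorm_apply (𝕜 := ℂ) (m := (2 * (d + 1), 0))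
        le_rfl le_rfl f p⟩
  have hC0 : 0 ≤ C := le_trans (by positivity) (hC 0)
  have hbound : ∀ (m : Fin d → ℤ) (w : Space d), ‖f (WithLp.toLp 2 (intVec m, w))‖ ≤
      (C * (1 + ‖intVec m‖) ^ (-((d : ℝ) + 1))) * (1 + ‖w‖) ^ (-((d : ℝ) + 1)) := by
    intro m w
    have h := hC (WithLp.toLp 2 (intVec m, w))
    set p : WithLp 2 (Space d × Space d) := WithLp.toLp 2 (intVec m, w)
    have h1 : ‖intVec m‖ ≤ ‖p‖ := WithLp.norm_fst_le _ p
    have h2 : ‖w‖ ≤ ‖p‖ := WithLp.norm_snd_le _ p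
    have e : ∀ r : ℝ, 0 ≤ r → (1 + r) ^ (-((d : ℝ) + 1)) = ((1 + r) ^ (d + 1))⁻¹ := by
      intro r hr
      rw [Real.rpow_neg (by positivity)]
      norm_cast
    rw [e _ (norm_nonneg _), e _ (norm_nonneg _), ← div_eq_mul_inv, ← div_eq_mul_inv, div_div,
      le_div_iff₀ (by positivity)]
    refine le_trans ?_ h
    have h3 : (1 + ‖p‖) ^ (2 * (d + 1)) = (1 + ‖p‖) ^ (d + 1) * (1 + ‖p‖) ^ (d + 1) := by
      rw [two_mul, pow_add]
    rw [h3, mul_comm ‖f p‖]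
    gcongr
  have hsum := summable_one_add_norm_intVec (d := d)
  refine ⟨⟨fun m w => f (WithLp.toLp 2 (intVec m, w)), _, _, fun m => ?_, hsum.mul_left C,
    integrable_one_add_norm (by simp), fun m => by positivity, fun w => by positivity, hbound,
    fun x w => ?_, ha.fourierInv_fourier⟩⟩
  · exact f.continuous.comp ((WithLp.prodContinuousLinearEquiv 2 ℝ (Space d) (Space d)).symm
      |>.continuous.comp (continuous_const.prodMk continuous_id))
  · let g : C(UnitAddTorus (Fin d), ℂ) :=
      ⟨fun θ => 𝓕 (fun ξ => a (unitTorusHomeo θ, ξ)) w,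
        (ha.continuous_fourier w).comp unitTorusHomeo.continuous⟩
    have hcoef : ∀ m, UnitAddTorus.mFourierCoeff g m = f (WithLp.toLp 2 (intVec m, w)) :=
      fun m => ha.mFourierCoeff_fourier m w
    have hs : Summable (UnitAddTorus.mFourierCoeff g) := by
      refine Summable.of_norm_bounded
        ((hsum.mul_left C).mul_right ((1 + ‖w‖) ^ (-((d : ℝ) + 1)))) fun m => ?_
      rw [hcoef]
      exact hbound m w
    have h := UnitAddTorus.hasSum_mFourier_series_apply_of_summable hs (unitTorusHomeo.symm x)
    simp only [hcoef, mFourier_eq_torusChar, Homeomorph.apply_symm_apply, smul_eq_mul] at h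
    simpa only [g, ContinuousMap.coe_mk, Homeomorph.apply_symm_apply] using h

namespace SymbolExpansion

variable {a : Phase d → ℂ} (S : SymbolExpansion a)

/-- The `m`-th Fourier coefficient in position of the symbol, as a function of momentum. -/
noncomputable def coeff (m : Fin d → ℤ) (ξ : Space d) : ℂ := 𝓕⁻ (S.mode m) ξ

/-- A summable bound for the Fourier coefficients, uniform in momentum. -/
noncomputable def coeffBound (m : Fin d → ℤ) : ℝ := S.modeBound m * ∫ w, S.profile w

lemma coeff_eq (m : Fin d → ℤ) (ξ : Space d) :
    S.coeff m ξ = ∫ w, Complex.exp (((2 * Real.pi * inner ℝ w ξ : ℝ) : ℂ) * Complex.I) *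
      S.mode m w := Real.fourierInv_eq' _ _

lemma summable_coeffBound : Summable S.coeffBound := S.summable_modeBound.mul_right _

lemma coeffBound_nonneg (m : Fin d → ℤ) : 0 ≤ S.coeffBound m :=
  mul_nonneg (S.modeBound_nonneg m) (integral_nonneg S.profile_nonneg)

lemma norm_coeff_le (m : Fin d → ℤ) (ξ : Space d) : ‖S.coeff m ξ‖ ≤ S.coeffBound m := by
  rw [coeff_eq, coeffBound, ← integral_const_mul]
  refine norm_integral_le_of_norm_le (S.integrable_profile.const_mul _) (.of_forall fun w => ?_)
  rw [norm_mul, Complex.norm_exp_ofReal_mul_I, one_mul]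
  exact S.norm_mode_le m w

lemma continuous_coeff (m : Fin d → ℤ) : Continuous (S.coeff m) := by
  have hc := S.continuous_mode m
  simp only [funext (S.coeff_eq m)]
  refine continuous_of_dominated (bound := fun w => S.modeBound m * S.profile w)
    (fun ξ => ?_) (fun ξ => .of_forall fun w => ?_) (S.integrable_profile.const_mul _)
    (.of_forall fun w => ?_)
  · exact Continuous.aestronglyMeasurable (by fun_prop)
  · rw [norm_mul, Complex.norm_exp_ofReal_mul_I, one_mul]
    exact S.norm_mode_le m w
  · fun_prop

/-- The Fourier series of the symbol in the position variable. -/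
lemma hasSum_coeff (x : Torus d) (ξ : Space d) :
    HasSum (fun m => S.coeff m ξ * torusChar m x) (a (x, ξ)) := by
  have hc := S.continuous_mode
  have h := hasSum_integral_of_summable_integral_norm (μ := (volume : Measure (Space d)))
    (F := fun m w => Complex.exp (((2 * Real.pi * inner ℝ w ξ : ℝ) : ℂ) * Complex.I) *
      (S.mode m w * torusChar m x)) ?_ ?_
  · have h1 : ∫ w, ∑' m, Complex.exp (((2 * Real.pi * inner ℝ w ξ : ℝ) : ℂ) * Complex.I) *
        (S.mode m w * torusChar m x) = a (x, ξ) := by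
      have h2 := congrFun (S.fourierInv_fourier x) ξ
      rw [Real.fourierInv_eq'] at h2
      rw [← h2]
      refine integral_congr_ae (.of_forall fun w => ?_)
      simp only [smul_eq_mul]
      rw [tsum_mul_left, (S.hasSum_mode x w).tsum_eq]
    rw [h1] at h
    refine h.congr_fun fun m => ?_
    rw [S.coeff_eq, ← integral_mul_const]
    simp only [mul_assoc]
  · intro m
    refine ((S.integrable_profile.const_mul (S.modeBound m))).mono'
      (Continuous.aestronglyMeasurable (by fun_prop)) (.of_forall fun w => ?_)
    rw [norm_mul, Complex.norm_exp_ofReal_mul_I, one_mul, norm_mul, norm_torusChar, mul_one]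
    exact S.norm_mode_le m w
  · refine Summable.of_nonneg_of_le (fun m => integral_nonneg fun w => norm_nonneg _)
      (fun m => ?_) S.summable_coeffBound
    rw [coeffBound, ← integral_const_mul]
    refine integral_mono_of_nonneg (.of_forall fun w => norm_nonneg _)
      (S.integrable_profile.const_mul _) (.of_forall fun w => ?_)
    simp only
    rw [norm_mul, Complex.norm_exp_ofReal_mul_I, one_mul, norm_mul, norm_torusChar, mul_one]
    exact S.norm_mode_le m w

end SymbolExpansion

/-! ### The Weyl quantization on trigonometric polynomials -/

lemma weylKernel_eq (h : ℝ) (a : Phase d → ℂ) (x y : Space d) :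
    weylKernel h a x y = (((2 * Real.pi * h) ^ d)⁻¹ : ℝ) *
      𝓕 (fun ξ => a (toTorus ((2⁻¹ : ℝ) • (x + y)), ξ)) ((2 * Real.pi * h)⁻¹ • (y - x)) := by
  rw [weylKernel, Real.fourier_eq']
  congr 1
  refine integral_congr_ae (.of_forall fun ξ => ?_)
  simp only [smul_eq_mul]
  rw [mul_comm]
  congr 2
  rw [mul_comm]
  congr 2
  rw [inner_smul_right, ← neg_sub x y, inner_neg_right]
  have hpi := Real.pi_ne_zero
  by_cases hh : h = 0
  · simp [hh]
  · field_simp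

/-- A trigonometric polynomial with frequencies in `F`. -/
noncomputable def trigPoly (F : Finset (Fin d → ℤ)) (c : (Fin d → ℤ) → ℂ) (x : Torus d) : ℂ :=
  ∑ k ∈ F, c k * torusMode k x

lemma continuous_trigPoly (F : Finset (Fin d → ℤ)) (c : (Fin d → ℤ) → ℂ) :
    Continuous (trigPoly F c) := by
  unfold trigPoly
  fun_prop

lemma norm_torusMode_le (k : Fin d → ℤ) (x : Torus d) : ‖torusMode k x‖ ≤ 1 := by
  rw [torusMode_eq, norm_mul, norm_torusChar, mul_one, Complex.norm_real, Real.norm_eq_abs,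
    abs_of_pos (by positivity)]
  exact inv_le_one_of_one_le₀ (Real.one_le_rpow (by linarith [Real.two_le_pi]) (by positivity))

lemma norm_trigPoly_le (F : Finset (Fin d → ℤ)) (c : (Fin d → ℤ) → ℂ) (x : Torus d) :
    ‖trigPoly F c x‖ ≤ ∑ k ∈ F, ‖c k‖ := by
  refine norm_sum_le_of_le _ fun k _ => ?_
  rw [norm_mul]
  exact mul_le_of_le_one_right (norm_nonneg _) (norm_torusMode_le k x)

/-- `Op_h(a)` maps the mode `k` to `∑ₘ aₘ(h (k + m / 2)) e_{k + m}`, where `aₘ` are the Fourier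
coefficients of `a` in the position variable. -/
lemma SymbolExpansion.hasSum_weylOp {a : Phase d → ℂ} (S : SymbolExpansion a) {h : ℝ} (hh : 0 < h)
    (F : Finset (Fin d → ℤ)) (c : (Fin d → ℤ) → ℂ) {u : Torus d → ℂ}
    (hu : u =ᵐ[volume] trigPoly F c) (X : Torus d) :
    HasSum (fun m => ∑ k ∈ F, c k * S.coeff m (h • (intVec k + (2⁻¹ : ℝ) • intVec m)) *
      torusMode (k + m) X) (weylOp h a u X) := by
  set x := cellRep X with hx
  have hX : toTorus x = X := toTorus_cellRep X
  set R := 2 * Real.pi * h with hR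
  have hR0 : 0 < R := by positivity
  have hcm := S.continuous_mode
  have hct := continuous_trigPoly F c
  have hcT := continuous_toTorus (d := d)
  set B := ∑ k ∈ F, ‖c k‖ with hB
  have hB0 : 0 ≤ B := Finset.sum_nonneg fun k _ => norm_nonneg _
  -- the change of variables `y = x + 2πh w`
  have hW : weylOp h a u X = ∫ w : Space d, ∑' m, S.mode m w *
      torusChar m (toTorus (x + (Real.pi * h) • w)) * trigPoly F c (toTorus (R • w + x)) := by
    have h1 : weylOp h a u X = ∫ y, weylKernel h a x y * trigPoly F c (toTorus y) := by
      refine integral_congr_ae ?_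
      filter_upwards [quasiMeasurePreserving_toTorus.ae_eq_comp hu] with y hy
      simp only [Function.comp_apply] at hy
      rw [hy]
    have h2 := Measure.integral_comp_smul (volume : Measure (Space d))
      (fun y => weylKernel h a x (y + x) * trigPoly F c (toTorus (y + x))) R
    rw [integral_add_right_eq_self (fun y => weylKernel h a x y * trigPoly F c (toTorus y)) x,
      ← h1] at h2
    have h3 : weylOp h a u X = (R ^ d : ℝ) • ∫ w, weylKernel h a x (R • w + x) *
        trigPoly F c (toTorus (R • w + x)) := by
      rw [h2, smul_smul, finrank_euclideanSpace_fin, abs_of_pos (by positivity),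
        mul_inv_cancel₀ (by positivity), one_smul]
    rw [h3, ← integral_smul]
    refine integral_congr_ae (.of_forall fun w => ?_)
    simp only
    have e1 : (2 * Real.pi * h)⁻¹ • (R • w + x - x) = w := by
      rw [add_sub_cancel_right, smul_smul, inv_mul_cancel₀ hR0.ne', one_smul]
    have e2 : (2⁻¹ : ℝ) • (x + (R • w + x)) = x + (Real.pi * h) • w := by
      rw [hR]; module
    rw [weylKernel_eq, e1, e2, tsum_mul_right, (S.hasSum_mode _ w).tsum_eq, Complex.real_smul,
      ← mul_assoc, ← mul_assoc, ← Complex.ofReal_mul, mul_inv_cancel₀ (by positivity),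
      Complex.ofReal_one, one_mul]
  have hnorm : ∀ m w, ‖S.mode m w * torusChar m (toTorus (x + (Real.pi * h) • w)) *
      trigPoly F c (toTorus (R • w + x))‖ ≤ S.modeBound m * S.profile w * B := by
    intro m w
    rw [norm_mul, norm_mul, norm_torusChar, mul_one]
    exact mul_le_mul (S.norm_mode_le m w) (norm_trigPoly_le F c _) (norm_nonneg _)
      (mul_nonneg (S.modeBound_nonneg m) (S.profile_nonneg w))
  have hint := hasSum_integral_of_summable_integral_norm (μ := (volume : Measure (Space d)))
    (F := fun m w => S.mode m w * torusChar m (toTorus (x + (Real.pi * h) • w)) *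
      trigPoly F c (toTorus (R • w + x))) ?_ ?_
  · rw [hW]
    refine hint.congr_fun fun m => ?_
    have hterm : ∀ w, S.mode m w * torusChar m (toTorus (x + (Real.pi * h) • w)) *
        trigPoly F c (toTorus (R • w + x)) = ∑ k ∈ F, c k * torusMode (k + m) X *
        (Complex.exp (((2 * Real.pi * inner ℝ w (h • (intVec k + (2⁻¹ : ℝ) • intVec m)) : ℝ) : ℂ)
          * Complex.I) * S.mode m w) := by
      intro w
      rw [trigPoly, Finset.mul_sum]
      refine Finset.sum_congr rfl fun k _ => ?_
      have e3 : Complex.exp (((2 * Real.pi *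
          inner ℝ w (h • (intVec k + (2⁻¹ : ℝ) • intVec m)) : ℝ) : ℂ) * Complex.I)
          = torusChar m (toTorus ((Real.pi * h) • w)) * torusChar k (toTorus (R • w)) := by
        rw [torusChar_toTorus, torusChar_toTorus, ← Complex.exp_add, inner_smul_right,
          inner_smul_right, inner_smul_right, inner_add_right, inner_smul_right, hR,
          real_inner_comm w (intVec k), real_inner_comm w (intVec m)]
        congr 1
        push_cast
        ring
      rw [e3, toTorus_add, toTorus_add, hX, torusChar_apply_add, torusMode_eq, torusMode_eq,
        torusChar_apply_add, torusChar_add]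
      ring
    simp only [hterm]
    rw [integral_finsetSum]
    · refine Finset.sum_congr rfl fun k _ => ?_
      rw [integral_const_mul, ← S.coeff_eq]
      ring
    · intro k _
      refine Integrable.const_mul ?_ _
      refine ((S.integrable_profile.const_mul (S.modeBound m))).mono'
        (Continuous.aestronglyMeasurable (by fun_prop)) (.of_forall fun w => ?_)
      rw [norm_mul, Complex.norm_exp_ofReal_mul_I, one_mul]
      exact S.norm_mode_le m w
  · intro m
    refine ((S.integrable_profile.const_mul (S.modeBound m)).mul_const B).mono'
      (Continuous.aestronglyMeasurable (by fun_prop)) (.of_forall (hnorm m))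
  · refine Summable.of_nonneg_of_le (fun m => integral_nonneg fun w => norm_nonneg _)
      (fun m => ?_) (S.summable_coeffBound.mul_right B)
    rw [SymbolExpansion.coeffBound, ← integral_const_mul, ← integral_mul_const]
    exact integral_mono_of_nonneg (.of_forall fun w => norm_nonneg _)
      ((S.integrable_profile.const_mul _).mul_const B) (.of_forall (hnorm m))

/-- The Wigner distribution of a trigonometric polynomial, in terms of its coefficients. -/
lemma SymbolExpansion.hasSum_wigner {a : Phase d → ℂ} (S : SymbolExpansion a) {h : ℝ} (hh : 0 < h)
    (F : Finset (Fin d → ℤ)) (c : (Fin d → ℤ) → ℂ) (hc : ∀ k ∉ F, c k = 0) {u : Torus d → ℂ}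
    (hu : u =ᵐ[volume] trigPoly F c) :
    HasSum (fun m => ∑ k ∈ F, (starRingEnd ℂ) (c (k + m)) * c k *
      S.coeff m (h • (intVec k + (2⁻¹ : ℝ) • intVec m))) (wigner h u a) := by
  classical
  set G : (Fin d → ℤ) → Torus d → ℂ := fun m X =>
    ∑ k ∈ F, c k * S.coeff m (h • (intVec k + (2⁻¹ : ℝ) • intVec m)) * torusMode (k + m) X with hG
  have hct := continuous_trigPoly F c
  have hGc : ∀ m, Continuous (G m) := fun m => by simp only [hG]; fun_prop
  set B := ∑ k ∈ F, ‖c k‖ with hB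
  have hB0 : 0 ≤ B := Finset.sum_nonneg fun k _ => norm_nonneg _
  have hGb : ∀ m X, ‖G m X‖ ≤ B * S.coeffBound m := by
    intro m X
    rw [hB, Finset.sum_mul]
    refine norm_sum_le_of_le _ fun k _ => ?_
    rw [norm_mul, norm_mul]
    exact (mul_le_of_le_one_right (by positivity) (norm_torusMode_le _ X)).trans
      (mul_le_mul_of_nonneg_left (S.norm_coeff_le _ _) (norm_nonneg _))
  have hnorm : ∀ m X, ‖(starRingEnd ℂ) (trigPoly F c X) * G m X‖ ≤ B * (B * S.coeffBound m) := by
    intro m X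
    rw [norm_mul, RCLike.norm_conj]
    exact mul_le_mul (norm_trigPoly_le F c X) (hGb m X) (norm_nonneg _) hB0
  have hW : wigner h u a = ∫ X, ∑' m, (starRingEnd ℂ) (trigPoly F c X) * G m X := by
    refine integral_congr_ae ?_
    filter_upwards [hu] with X hX
    rw [hX, tsum_mul_left, (S.hasSum_weylOp hh F c hu X).tsum_eq]
  have hint := hasSum_integral_of_summable_integral_norm (μ := (volume : Measure (Torus d)))
    (F := fun m X => (starRingEnd ℂ) (trigPoly F c X) * G m X) ?_ ?_
  · rw [hW]
    refine hint.congr_fun fun m => ?_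
    have hterm : ∀ X, (starRingEnd ℂ) (trigPoly F c X) * G m X = ∑ k ∈ F, ∑ j ∈ F,
        (starRingEnd ℂ) (c j) * c k * S.coeff m (h • (intVec k + (2⁻¹ : ℝ) • intVec m)) *
        ((starRingEnd ℂ) (torusMode j X) * torusMode (k + m) X) := by
      intro X
      simp only [hG, trigPoly, map_sum, map_mul]
      rw [Finset.sum_mul_sum, Finset.sum_comm]
      refine Finset.sum_congr rfl fun k _ => Finset.sum_congr rfl fun j _ => ?_
      ring
    have hI : ∀ (j l : Fin d → ℤ) (C : ℂ),
        Integrable fun X : Torus d => C * ((starRingEnd ℂ) (torusMode j X) * torusMode l X) := by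
      intro j l C
      refine Continuous.integrable_of_hasCompactSupport ?_ (HasCompactSupport.of_compactSpace _)
      exact continuous_const.mul ((Complex.continuous_conj.comp (torusMode j).continuous).mul
        (torusMode l).continuous)
    simp only [hterm]
    rw [integral_finsetSum _ fun k _ => integrable_finsetSum _ fun j _ => hI j (k + m) _]
    refine Finset.sum_congr rfl fun k _ => ?_
    rw [integral_finsetSum _ fun j _ => hI j (k + m) _]
    simp only [integral_const_mul, integral_conj_torusMode_mul, mul_ite, mul_one, mul_zero]
    rw [Finset.sum_ite_eq' F (k + m)]
    split_ifs with hkm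
    · rfl
    · simp [hc _ hkm]
  · intro m
    refine Continuous.integrable_of_hasCompactSupport ?_ (HasCompactSupport.of_compactSpace _)
    exact (Complex.continuous_conj.comp hct).mul (hGc m)
  · refine Summable.of_nonneg_of_le (fun m => integral_nonneg fun w => norm_nonneg _)
      (fun m => ?_) (((S.summable_coeffBound.mul_left B).mul_left B).mul_left
        ((volume : Measure (Torus d)).real Set.univ))
    refine (integral_mono_of_nonneg (.of_forall fun w => norm_nonneg _)
      (integrable_const _) (.of_forall (hnorm m))).trans ?_
    rw [integral_const, smul_eq_mul]

/-! ### The propagated wave packet as a trigonometric polynomial -/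

/-- The Fourier coefficients of a periodization are integrals over `ℝ^d`. -/
lemma fourierCoeffTorus_periodize {v : Space d → ℂ} (hv : Integrable v) (k : Fin d → ℤ) :
    fourierCoeffTorus (periodize v) k =
      ∫ y, v y * (starRingEnd ℂ) (torusMode k (toTorus y)) := by
  set f : Space d → ℂ := fun y => v y * (starRingEnd ℂ) (torusMode k (toTorus y)) with hf
  have hcm : Continuous fun y : Space d => (starRingEnd ℂ) (torusMode k (toTorus y)) :=
    Complex.continuous_conj.comp ((torusMode k).continuous.comp continuous_toTorus)
  have hint : Integrable f := by
    refine hv.norm.mono' (hv.aestronglyMeasurable.mul hcm.aestronglyMeasurable)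
      (.of_forall fun y => ?_)
    rw [hf, norm_mul, RCLike.norm_conj]
    exact mul_le_of_le_one_right (norm_nonneg _) (norm_torusMode_le k _)
  rw [← setIntegral_latticeCell_tsum Real.two_pi_pos hint, ← measurePreserving_cellRep.map_eq,
    integral_map measurable_cellRep.aemeasurable]
  · refine integral_congr_ae (.of_forall fun x => ?_)
    simp only [periodize, hf, toTorus_add_period, toTorus_cellRep]
    rw [tsum_mul_right]
  · rw [measurePreserving_cellRep.map_eq]
    exact aestronglyMeasurable_tsum_latticeCell hint

/-- The centre in frequency `ξ₀ / h + η₀ / (h τ)` of the wave packet. -/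
noncomputable def packetFrequency (ξ₀ η₀ : Space d) (h τ : ℝ) : Space d :=
  h⁻¹ • ξ₀ + (h * τ)⁻¹ • η₀

lemma integrable_modulatedPacket (ρ : 𝓢(Space d, ℂ)) (x₀ ξ₀ η₀ : Space d) {h τ ε : ℝ}
    (hε : 0 < ε) : Integrable (modulatedPacket (fun x => ρ x) x₀ ξ₀ η₀ h τ ε) := by
  have h1 : Integrable fun x => ρ (ε⁻¹ • (x - x₀)) :=
    (ρ.integrable.comp_smul (inv_ne_zero hε.ne')).comp_sub_right x₀
  refine (h1.norm.const_mul ‖((ε ^ ((d : ℝ) / 2))⁻¹ : ℝ)‖).mono' ?_ (.of_forall fun x => ?_)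
  · have hρ := ρ.continuous
    unfold modulatedPacket
    exact Continuous.aestronglyMeasurable (by fun_prop)
  · rw [modulatedPacket, norm_mul, norm_mul, norm_mul, mul_comm Complex.I,
      mul_comm Complex.I, Complex.norm_exp_ofReal_mul_I, Complex.norm_exp_ofReal_mul_I, mul_one,
      mul_one, Complex.norm_real]

/-- The Fourier coefficients of the periodized wave packet. -/
lemma fourierCoeffTorus_modulatedPacket (ρ : 𝓢(Space d, ℂ)) (x₀ ξ₀ η₀ : Space d) {h τ ε : ℝ}
    (hε : 0 < ε) (k : Fin d → ℤ) :
    fourierCoeffTorus (periodize (modulatedPacket (fun x => ρ x) x₀ ξ₀ η₀ h τ ε)) k =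
      (((ε / (2 * Real.pi)) ^ ((d : ℝ) / 2) : ℝ) : ℂ) *
        Complex.exp (Complex.I *
          ((inner ℝ (packetFrequency ξ₀ η₀ h τ - intVec k) x₀ : ℝ) : ℂ)) *
        𝓕 ρ ((ε / (2 * Real.pi)) • (intVec k - packetFrequency ξ₀ η₀ h τ)) := by
  rw [fourierCoeffTorus_periodize (integrable_modulatedPacket ρ x₀ ξ₀ η₀ hε)]
  set ζ := packetFrequency ξ₀ η₀ h τ with hζ
  set δ := ε / (2 * Real.pi) with hδ
  set f : Space d → ℂ := fun y => modulatedPacket (fun x => ρ x) x₀ ξ₀ η₀ h τ ε y *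
    (starRingEnd ℂ) (torusMode k (toTorus y)) with hf
  have h2 := Measure.integral_comp_smul (volume : Measure (Space d)) (fun y => f (y + x₀)) ε
  rw [integral_add_right_eq_self f x₀] at h2
  have h3 : ∫ y, f y = (ε ^ d : ℝ) • ∫ z, f (ε • z + x₀) := by
    rw [h2, smul_smul, finrank_euclideanSpace_fin, abs_of_pos (by positivity),
      mul_inv_cancel₀ (by positivity), one_smul]
  have hterm : ∀ z, f (ε • z + x₀) = ((((ε ^ ((d : ℝ) / 2))⁻¹ : ℝ) : ℂ) *
      (((2 * Real.pi) ^ ((d : ℝ) / 2))⁻¹ : ℝ) *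
      Complex.exp (Complex.I * ((inner ℝ (ζ - intVec k) x₀ : ℝ) : ℂ))) *
      (Complex.exp (((-2 * Real.pi * inner ℝ z (δ • (intVec k - ζ)) : ℝ) : ℂ) * Complex.I) *
        ρ z) := by
    intro z
    have e1 : ε⁻¹ • (ε • z + x₀ - x₀) = z := by
      rw [add_sub_cancel_right, smul_smul, inv_mul_cancel₀ hε.ne', one_smul]
    have e2 : Complex.exp (Complex.I * ((inner ℝ ξ₀ (ε • z + x₀) / h : ℝ) : ℂ)) *
        Complex.exp (Complex.I * ((inner ℝ η₀ (ε • z + x₀) / (h * τ) : ℝ) : ℂ)) *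
        (starRingEnd ℂ) (torusChar k (toTorus (ε • z + x₀))) =
        Complex.exp (Complex.I * ((inner ℝ (ζ - intVec k) x₀ : ℝ) : ℂ)) *
        Complex.exp (((-2 * Real.pi * inner ℝ z (δ • (intVec k - ζ)) : ℝ) : ℂ) * Complex.I) := by
      rw [← torusChar_neg, torusChar_toTorus, ← Complex.exp_add, ← Complex.exp_add,
        ← Complex.exp_add, ← mul_add, ← mul_add, mul_comm _ Complex.I, ← mul_add,
        ← Complex.ofReal_add, ← Complex.ofReal_add, ← Complex.ofReal_add]
      congr 3
      have hpi := Real.pi_ne_zero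
      have e3 : -2 * Real.pi * inner ℝ z (δ • (intVec k - ζ)) =
          ε * inner ℝ (ζ - intVec k) z := by
        rw [inner_smul_right, hδ, real_inner_comm, ← neg_sub ζ, inner_neg_left]
        field_simp
      rw [e3, hζ, packetFrequency, intVec_neg, inner_neg_left, inner_sub_left, inner_sub_left,
        inner_add_left, inner_add_left, inner_smul_left, inner_smul_left, inner_smul_left,
        inner_smul_left, inner_add_right, inner_add_right, inner_add_right, inner_smul_right,
        inner_smul_right, inner_smul_right]
      simp only [conj_trivial, div_eq_inv_mul]
      ring
    simp only [hf, modulatedPacket, torusMode_eq, e1, map_mul, Complex.conj_ofReal]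
    linear_combination ((((ε ^ ((d : ℝ) / 2))⁻¹ : ℝ) : ℂ) *
      (((2 * Real.pi) ^ ((d : ℝ) / 2))⁻¹ : ℝ) * ρ z) * e2
  rw [h3]
  simp only [hterm]
  rw [integral_const_mul, SchwartzMap.fourier_coe, Real.fourier_eq']
  simp only [smul_eq_mul, Complex.real_smul]
  have hcoef : ε ^ d * ((ε ^ ((d : ℝ) / 2))⁻¹ * ((2 * Real.pi) ^ ((d : ℝ) / 2))⁻¹)
      = δ ^ ((d : ℝ) / 2) := by
    have h4 : ε ^ ((d : ℝ) / 2) * ε ^ ((d : ℝ) / 2) = ε ^ d := by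
      rw [← Real.rpow_add hε, add_halves, Real.rpow_natCast]
    have h5 : ε ^ ((d : ℝ) / 2) ≠ 0 := (Real.rpow_pos_of_pos hε _).ne'
    rw [hδ, Real.div_rpow hε.le Real.two_pi_pos.le, ← h4]
    field_simp
  rw [← hcoef]
  push_cast
  ring

lemma finite_setOf_norm_intVec_le (R : ℝ) : {k : Fin d → ℤ | ‖intVec k‖ ≤ R}.Finite := by
  refine (Set.finite_Icc (fun _ : Fin d => -⌈R⌉) (fun _ => ⌈R⌉)).subset fun k hk => ?_
  have h : ∀ i, |(k i : ℝ)| ≤ ⌈R⌉ := fun i =>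
    ((PiLp.norm_apply_le (intVec k) i).trans hk).trans (Int.le_ceil R)
  refine ⟨fun i => ?_, fun i => ?_⟩
  · have := neg_le_of_abs_le (h i); exact_mod_cast this
  · have := le_of_abs_le (h i); exact_mod_cast this

lemma exists_finset_fourier_eq_zero {g : Space d → ℂ} (hg : HasCompactSupport g) {δ : ℝ}
    (hδ : 0 < δ) (ζ : Space d) :
    ∃ F : Finset (Fin d → ℤ), ∀ k ∉ F, g (δ • (intVec k - ζ)) = 0 := by
  obtain ⟨R, hR⟩ := hg.isBounded.exists_norm_le
  refine ⟨(finite_setOf_norm_intVec_le (R / δ + ‖ζ‖)).toFinset, fun k hk => ?_⟩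
  by_contra h
  refine hk ?_
  have h1 := hR _ (subset_tsupport _ h)
  rw [norm_smul, Real.norm_of_nonneg hδ.le, mul_comm, ← le_div_iff₀ hδ] at h1
  simp only [Set.Finite.mem_toFinset, Set.mem_ofPred_eq]
  have h2 := norm_add_le (intVec k - ζ) ζ
  rw [sub_add_cancel] at h2
  linarith

/-- If only finitely many Fourier coefficients of `u` are non-zero, the propagated function is a
trigonometric polynomial. -/
lemma propagator_ae_eq (H : Space d → ℝ) (h s : ℝ) (u : Torus d → ℂ) (F : Finset (Fin d → ℤ))
    (hF : ∀ k ∉ F, fourierCoeffTorus u k = 0) :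
    propagator H h s u =ᵐ[volume] trigPoly F fun k =>
      Complex.exp (-Complex.I * ((s / h * H (h • intVec k) : ℝ) : ℂ)) * fourierCoeffTorus u k := by
  rw [propagator, tsum_eq_sum (s := F) fun k hk => by rw [hF k hk, mul_zero, zero_smul]]
  simp only [← map_smul, ← map_sum]
  refine (ContinuousMap.coeFn_toLp (𝕜 := ℂ) (E := ℂ) (p := 2) (volume : Measure (Torus d)) _).trans
    (.of_forall fun x => ?_)
  simp [trigPoly, ContinuousMap.coe_sum]

/-- The rescaled frequency `(τ / h) (H(h (k + m)) - H(h k))` of the interference in time between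
the modes `k + m` and `k`. -/
noncomputable def beatFrequency (H : Space d → ℝ) (h τ : ℝ) (m k : Fin d → ℤ) : ℝ :=
  τ / h * (H (h • intVec (k + m)) - H (h • intVec k))

/-- The amplitude of the interference between the modes `k + m` and `k` in the Wigner distribution
of the initial wave packet with envelope `g` in frequency. -/
noncomputable def beatAmplitude {a : Phase d → ℂ} (S : SymbolExpansion a) (g : Space d → ℂ)
    (x₀ ζ : Space d) (δ h : ℝ) (m k : Fin d → ℤ) : ℂ :=
  torusChar m (toTorus x₀) *
    ((starRingEnd ℂ) (g (δ • (intVec (k + m) - ζ))) * g (δ • (intVec k - ζ))) *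
    S.coeff m (h • (intVec k + (2⁻¹ : ℝ) • intVec m))

/-- The Wigner distribution of the propagated wave packet, mode by mode. -/
lemma hasSum_wigner_propagator {a : Phase d → ℂ} (S : SymbolExpansion a) (H : Space d → ℝ)
    (ρ : 𝓢(Space d, ℂ)) (x₀ ξ₀ η₀ : Space d) {h τ ε : ℝ} (hh : 0 < h) (hε : 0 < ε)
    (F : Finset (Fin d → ℤ)) (hF : ∀ k ∉ F, 𝓕 ρ ((ε / (2 * Real.pi)) •
      (intVec k - packetFrequency ξ₀ η₀ h τ)) = 0) (t : ℝ) :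
    HasSum (fun m => (((ε / (2 * Real.pi)) ^ d : ℝ) : ℂ) * ∑ k ∈ F,
        Complex.exp (((t * beatFrequency H h τ m k : ℝ) : ℂ) * Complex.I) *
        beatAmplitude S (𝓕 ρ : 𝓢(Space d, ℂ)) x₀ (packetFrequency ξ₀ η₀ h τ) (ε / (2 * Real.pi))
          h m k)
      (wigner h (propagator H h (τ * t)
        (periodize (modulatedPacket (fun x => ρ x) x₀ ξ₀ η₀ h τ ε))) a) := by
  have hcoef := fourierCoeffTorus_modulatedPacket ρ x₀ ξ₀ η₀ (h := h) (τ := τ) hε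
  set ζ := packetFrequency ξ₀ η₀ h τ with hζ
  set δ := ε / (2 * Real.pi) with hδ
  have hδ0 : 0 < δ := div_pos hε Real.two_pi_pos
  set u := periodize (modulatedPacket (fun x => ρ x) x₀ ξ₀ η₀ h τ ε) with hu
  have hF' : ∀ k ∉ F, fourierCoeffTorus u k = 0 := fun k hk => by rw [hcoef, hF k hk, mul_zero]
  have hW := S.hasSum_wigner hh F _ (fun k hk => by rw [hF' k hk, mul_zero])
    (propagator_ae_eq H h (τ * t) u F hF')
  refine hW.congr_fun fun m => ?_
  rw [Finset.mul_sum]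
  refine Finset.sum_congr rfl fun k _ => ?_
  have h2 : (((δ ^ d : ℝ)) : ℂ) =
      ((δ ^ ((d : ℝ) / 2) : ℝ) : ℂ) * ((δ ^ ((d : ℝ) / 2) : ℝ) : ℂ) := by
    rw [← Complex.ofReal_mul, ← Real.rpow_add hδ0, add_halves, Real.rpow_natCast]
  have e1 : (starRingEnd ℂ)
        (Complex.exp (-Complex.I * ((τ * t / h * H (h • intVec (k + m)) : ℝ) : ℂ))) *
      Complex.exp (-Complex.I * ((τ * t / h * H (h • intVec k) : ℝ) : ℂ)) =
      Complex.exp (((t * beatFrequency H h τ m k : ℝ) : ℂ) * Complex.I) := by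
    rw [← Complex.exp_conj, ← Complex.exp_add, map_mul, map_neg, Complex.conj_I,
      Complex.conj_ofReal, beatFrequency]
    congr 1
    push_cast
    ring
  have e2 : (starRingEnd ℂ) (Complex.exp (Complex.I * ((inner ℝ (ζ - intVec (k + m)) x₀ : ℝ) : ℂ)))
      * Complex.exp (Complex.I * ((inner ℝ (ζ - intVec k) x₀ : ℝ) : ℂ)) =
      torusChar m (toTorus x₀) := by
    rw [torusChar_toTorus, ← Complex.exp_conj, ← Complex.exp_add, map_mul, Complex.conj_I,
      Complex.conj_ofReal, intVec_add, inner_sub_left, inner_sub_left, inner_add_left]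
    congr 1
    push_cast
    ring
  rw [hcoef, hcoef, beatAmplitude, h2, ← e1, ← e2]
  simp only [map_mul, Complex.conj_ofReal]
  ring

/-! ### Uniform measures on orbits -/

/-- The closure in the torus of the one-parameter subgroup with velocity `v`. -/
noncomputable def orbitClosure (v : Space d) : AddSubgroup (Torus d) :=
  (AddMonoidHom.range (AddMonoidHom.mk' (fun s : ℝ => toTorus (s • v))
    fun s t => by rw [add_smul, toTorus_add])).topologicalClosure

lemma isClosed_orbitClosure (v : Space d) : IsClosed (orbitClosure v : Set (Torus d)) :=
  AddSubgroup.isClosed_topologicalClosure _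

instance compactSpace_orbitClosure (v : Space d) : CompactSpace (orbitClosure v) :=
  isCompact_iff_compactSpace.1 (isClosed_orbitClosure v).isCompact

lemma toTorus_smul_mem_orbitClosure (v : Space d) (s : ℝ) : toTorus (s • v) ∈ orbitClosure v :=
  AddSubgroup.le_topologicalClosure _ ⟨s, rfl⟩

/-- The Haar probability measure of the closure of a one-parameter subgroup. -/
noncomputable def orbitHaar (v : Space d) : Measure (orbitClosure v) :=
  Measure.addHaarMeasure ⊤

instance (v : Space d) : (orbitHaar v).IsAddHaarMeasure := by
  unfold orbitHaar; infer_instance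

instance (v : Space d) : IsProbabilityMeasure (orbitHaar v) := by
  refine ⟨?_⟩
  have := Measure.addHaarMeasure_self
    (K₀ := (⊤ : TopologicalSpace.PositiveCompacts (orbitClosure v)))
  simpa [orbitHaar] using this

lemma integral_orbitHaar_torusChar (v : Space d) (m : Fin d → ℤ) :
    ∫ g : orbitClosure v, torusChar m (g : Torus d) ∂(orbitHaar v) =
      if inner ℝ (intVec m) v = 0 then 1 else 0 := by
  split_ifs with h
  · have h1 : ∀ g ∈ orbitClosure v, torusChar m g = 1 := by
      have hcl : IsClosed {g : Torus d | torusChar m g = 1} :=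
        isClosed_eq (torusChar m).continuous continuous_const
      intro g hg
      refine closure_minimal ?_ hcl hg
      rintro _ ⟨s, rfl⟩
      change torusChar m (toTorus (s • v)) = 1
      rw [torusChar_toTorus, inner_smul_right, h]
      simp
    simp [fun g : orbitClosure v => h1 g g.2]
  · -- translation along the orbit by half a period changes the sign of the character
    let g₀ : orbitClosure v :=
      ⟨toTorus ((Real.pi / inner ℝ (intVec m) v) • v), toTorus_smul_mem_orbitClosure v _⟩
    have hg₀ : torusChar m (g₀ : Torus d) = -1 := by
      change torusChar m (toTorus ((Real.pi / inner ℝ (intVec m) v) • v)) = -1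
      rw [torusChar_toTorus, inner_smul_right, div_mul_cancel₀ _ h, mul_comm,
        Complex.exp_pi_mul_I]
    have h1 := integral_add_right_eq_self (μ := orbitHaar v)
      (fun g : orbitClosure v => torusChar m (g : Torus d)) g₀
    simp only [AddSubgroup.coe_add, torusChar_apply_add, hg₀, mul_neg, mul_one,
      integral_neg] at h1
    have h2 : (2 : ℂ) * ∫ g : orbitClosure v, torusChar m (g : Torus d) ∂(orbitHaar v) = 0 := by
      linear_combination -h1
    simpa using h2

lemma tendsto_average_exp (c : ℝ) :
    Tendsto (fun T : ℝ => ((1 / T : ℝ) : ℂ) *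
      ∫ s in (0 : ℝ)..T, Complex.exp (Complex.I * ((s * c : ℝ) : ℂ))) atTop
      (𝓝 (if c = 0 then 1 else 0)) := by
  split_ifs with hc
  · refine tendsto_const_nhds.congr' ?_
    filter_upwards [eventually_gt_atTop 0] with T hT
    simp [hc, hT.ne']
  · have hc' : (c : ℂ) ≠ 0 := by exact_mod_cast hc
    refine squeeze_zero_norm' (a := fun T => (2 / |c|) * T⁻¹) ?_ ?_
    · filter_upwards [eventually_gt_atTop 0] with T hT
      have h1 : ∫ s in (0 : ℝ)..T, Complex.exp (Complex.I * ((s * c : ℝ) : ℂ)) =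
          (Complex.exp (((T * c : ℝ) : ℂ) * Complex.I) - 1) / (Complex.I * c) := by
        have h2 := integral_exp_mul_complex (a := 0) (b := T) (c := Complex.I * c)
          (mul_ne_zero Complex.I_ne_zero hc')
        have h3 : ∀ s : ℝ, Complex.I * ((s * c : ℝ) : ℂ) = Complex.I * c * s := by
          intro s; push_cast; ring
        simp only [h3, h2]
        congr 2
        · congr 1; push_cast; ring
        · simp
      have h4 : ‖Complex.exp (((T * c : ℝ) : ℂ) * Complex.I) - 1‖ ≤ 2 := by
        refine (norm_sub_le _ _).trans ?_
        rw [Complex.norm_exp_ofReal_mul_I, norm_one]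
        norm_num
      rw [h1, norm_mul, norm_div, norm_mul, Complex.norm_I, one_mul, Complex.norm_real,
        Complex.norm_real, Real.norm_eq_abs, Real.norm_eq_abs, abs_of_pos (by positivity),
        one_div, mul_comm]
      gcongr
    · simpa using tendsto_inv_atTop_zero.const_mul (2 / |c|)

/-- Weyl equidistribution: the time averages of a continuous function along a line in the torus
converge to its average over the closure of the orbit. -/
lemma tendsto_average_torus (x v : Space d) (f : C(Torus d, ℂ)) :
    Tendsto (fun T : ℝ => ((1 / T : ℝ) : ℂ) *
      ∫ s in (0 : ℝ)..T, f (toTorus (x + s • v))) atTop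
      (𝓝 (∫ g : orbitClosure v, f (toTorus x + g) ∂(orbitHaar v))) := by
  have hline : Continuous fun s : ℝ => toTorus (x + s • v) :=
    continuous_toTorus.comp (by fun_prop)
  have hgc : Continuous fun g : orbitClosure v => toTorus x + (g : Torus d) := by fun_prop
  set A : C(Torus d, ℂ) → ℝ → ℂ := fun f T => ((1 / T : ℝ) : ℂ) *
    ∫ s in (0 : ℝ)..T, f (toTorus (x + s • v)) with hA
  set L : C(Torus d, ℂ) → ℂ := fun f =>
    ∫ g : orbitClosure v, f (toTorus x + g) ∂(orbitHaar v) with hL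
  have hAi : ∀ (f : C(Torus d, ℂ)) (T : ℝ),
      IntervalIntegrable (fun s => f (toTorus (x + s • v))) volume 0 T :=
    fun f T => (f.continuous.comp hline).intervalIntegrable _ _
  have hLi : ∀ f : C(Torus d, ℂ),
      Integrable (fun g : orbitClosure v => f (toTorus x + g)) (orbitHaar v) := fun f =>
    (f.continuous.comp hgc).integrable_of_hasCompactSupport (HasCompactSupport.of_compactSpace _)
  have hAsub : ∀ f p T, A f T - A p T = A (f - p) T := by
    intro f p T
    simp only [hA, ContinuousMap.sub_apply]
    rw [intervalIntegral.integral_sub (hAi f T) (hAi p T), mul_sub]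
  have hLsub : ∀ f p, L f - L p = L (f - p) := by
    intro f p
    simp only [hL, ContinuousMap.sub_apply]
    rw [integral_sub (hLi f) (hLi p)]
  have hAn : ∀ f T, 0 < T → ‖A f T‖ ≤ ‖f‖ := by
    intro f T hT
    have h1 := intervalIntegral.norm_integral_le_of_norm_le_const (a := 0) (b := T)
      (f := fun s : ℝ => f (toTorus (x + s • v))) fun s _ => f.norm_coe_le_norm _
    rw [sub_zero, abs_of_pos hT] at h1
    simp only [hA]
    rw [norm_mul, Complex.norm_real, Real.norm_eq_abs, abs_of_pos (by positivity), one_div]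
    calc T⁻¹ * _ ≤ T⁻¹ * (‖f‖ * T) := by gcongr
      _ = ‖f‖ := by field_simp
  have hLn : ∀ f, ‖L f‖ ≤ ‖f‖ := by
    intro f
    have h1 := norm_integral_le_of_norm_le_const (μ := orbitHaar v) (C := ‖f‖)
      (f := fun g : orbitClosure v => f (toTorus x + g)) (.of_forall fun g => f.norm_coe_le_norm _)
    simpa using h1
  -- the characters
  have hchar : ∀ m, Tendsto (A (torusChar m)) atTop (𝓝 (L (torusChar m))) := by
    intro m
    have h1 : L (torusChar m) = torusChar m (toTorus x) *
        if inner ℝ (intVec m) v = 0 then 1 else 0 := by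
      simp only [hL, torusChar_apply_add]
      rw [integral_const_mul, integral_orbitHaar_torusChar]
    rw [h1]
    refine ((tendsto_average_exp (inner ℝ (intVec m) v)).const_mul
      (torusChar m (toTorus x))).congr fun T => ?_
    simp only [hA, toTorus_add, torusChar_apply_add]
    rw [intervalIntegral.integral_const_mul]
    simp only [torusChar_toTorus, inner_smul_right]
    ring
  -- trigonometric polynomials are dense
  let Ψ : C(UnitAddTorus (Fin d), ℂ) → C(Torus d, ℂ) := fun p =>
    p.comp ⟨unitTorusHomeo.symm, unitTorusHomeo.symm.continuous⟩
  have hpoly : ∀ p ∈ Submodule.span ℂ (Set.range (UnitAddTorus.mFourier (d := Fin d))),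
      Tendsto (A (Ψ p)) atTop (𝓝 (L (Ψ p))) := by
    intro p hp
    induction hp using Submodule.span_induction with
    | mem p hp =>
      obtain ⟨m, rfl⟩ := hp
      have : Ψ (UnitAddTorus.mFourier m) = torusChar m := by
        ext y
        simp [Ψ, mFourier_eq_torusChar]
      rw [this]
      exact hchar m
    | zero =>
      have h1 : A (Ψ 0) = fun _ => 0 := by funext T; simp [hA, Ψ]
      have h2 : L (Ψ 0) = 0 := by simp [hL, Ψ]
      rw [h1, h2]
      exact tendsto_const_nhds
    | add p q _ _ hp hq =>
      have h1 : A (Ψ (p + q)) = fun T => A (Ψ p) T + A (Ψ q) T := by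
        funext T
        simp only [hA]
        rw [← mul_add, ← intervalIntegral.integral_add (hAi _ T) (hAi _ T)]
        rfl
      have h2 : L (Ψ (p + q)) = L (Ψ p) + L (Ψ q) := by
        simp only [hL]
        rw [← integral_add (hLi _) (hLi _)]
        rfl
      rw [h1, h2]
      exact hp.add hq
    | smul c p _ hp =>
      have h1 : A (Ψ (c • p)) = fun T => c * A (Ψ p) T := by
        funext T
        simp only [hA]
        rw [mul_left_comm, ← intervalIntegral.integral_const_mul c]
        rfl
      have h2 : L (Ψ (c • p)) = c * L (Ψ p) := by
        simp only [hL]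
        rw [← integral_const_mul]
        rfl
      rw [h1, h2]
      exact hp.const_mul c
  change Tendsto (A f) atTop (𝓝 (L f))
  rw [Metric.tendsto_atTop']
  intro ε hε
  let f' : C(UnitAddTorus (Fin d), ℂ) := f.comp ⟨unitTorusHomeo, unitTorusHomeo.continuous⟩
  have hf' : f' ∈ (Submodule.span ℂ
      (Set.range (UnitAddTorus.mFourier (d := Fin d)))).topologicalClosure := by
    rw [UnitAddTorus.span_mFourier_closure_eq_top]; trivial
  obtain ⟨p, hp, hfp⟩ := Metric.mem_closure_iff.1 hf' (ε / 3) (by positivity)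
  have hdist : ‖f - Ψ p‖ < ε / 3 := by
    rw [dist_eq_norm, ContinuousMap.norm_lt_iff _ (by positivity)] at hfp
    rw [ContinuousMap.norm_lt_iff _ (by positivity)]
    intro y
    simpa [f', Ψ] using hfp (unitTorusHomeo.symm y)
  obtain ⟨N, hN⟩ := Metric.tendsto_atTop'.1 (hpoly p hp) (ε / 3) (by positivity)
  refine ⟨max N 0, fun T hT => ?_⟩
  have h1 := hN T ((le_max_left _ _).trans_lt hT)
  have h2 := hAn (f - Ψ p) T ((le_max_right _ _).trans_lt hT)
  have h3 := hLn (f - Ψ p)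
  rw [← hAsub] at h2
  rw [← hLsub] at h3
  rw [dist_eq_norm] at h1 ⊢
  calc ‖A f T - L f‖ = ‖(A f T - A (Ψ p) T) + (A (Ψ p) T - L (Ψ p)) - (L f - L (Ψ p))‖ := by
        congr 1; ring
    _ ≤ ‖A f T - A (Ψ p) T‖ + ‖A (Ψ p) T - L (Ψ p)‖ + ‖L f - L (Ψ p)‖ :=
        (norm_sub_le _ _).trans (add_le_add_left (norm_add_le _ _) _)
    _ < ε := by linarith

/-- The uniform probability measure on the closure of the orbit of velocity `v` issued from
`(x, ξ)`. -/
noncomputable def orbitMeasure (v x ξ : Space d) : Measure (Phase d) :=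
  (orbitHaar v).map fun g : orbitClosure v => (toTorus x + (g : Torus d), ξ)

lemma continuous_orbitMap (v x ξ : Space d) :
    Continuous fun g : orbitClosure v => ((toTorus x + (g : Torus d), ξ) : Phase d) := by
  fun_prop

lemma integral_orbitMeasure (v x ξ : Space d) {a : Phase d → ℂ} (ha : Continuous a) :
    ∫ z, a z ∂(orbitMeasure v x ξ) =
      ∫ g : orbitClosure v, a (toTorus x + g, ξ) ∂(orbitHaar v) :=
  integral_map (continuous_orbitMap v x ξ).measurable.aemeasurable ha.aestronglyMeasurable

lemma isUniformOrbitMeasure_orbitMeasure (H : Space d → ℝ) (x ξ : Space d) :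
    IsUniformOrbitMeasure H x ξ (orbitMeasure (gradient H ξ) x ξ) := by
  refine ⟨Measure.isProbabilityMeasure_map
    (continuous_orbitMap _ x ξ).measurable.aemeasurable, fun a ha _ => ?_⟩
  rw [integral_orbitMeasure _ x ξ ha]
  exact tendsto_average_torus x (gradient H ξ)
    ⟨fun y => a (y, ξ), ha.comp (continuous_id.prodMk continuous_const)⟩

/-- Only the resonant Fourier modes contribute to averages over an orbit. -/
lemma SymbolExpansion.hasSum_integral_orbitMeasure {a : Phase d → ℂ} (S : SymbolExpansion a)
    (ha : Continuous a) (v x ξ : Space d) :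
    HasSum (fun m => if inner ℝ (intVec m) v = 0 then S.coeff m ξ * torusChar m (toTorus x) else 0)
      (∫ z, a z ∂(orbitMeasure v x ξ)) := by
  rw [integral_orbitMeasure v x ξ ha]
  have hcont : ∀ m, Continuous fun g : orbitClosure v =>
      S.coeff m ξ * torusChar m (toTorus x + (g : Torus d)) := fun m => by fun_prop
  have h := hasSum_integral_of_summable_integral_norm (μ := orbitHaar v)
    (F := fun m g => S.coeff m ξ * torusChar m (toTorus x + (g : Torus d))) ?_ ?_
  · have h1 : ∀ g : orbitClosure v, ∑' m, S.coeff m ξ * torusChar m (toTorus x + (g : Torus d)) =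
        a (toTorus x + g, ξ) := fun g => (S.hasSum_coeff _ ξ).tsum_eq
    simp only [h1] at h
    refine h.congr_fun fun m => ?_
    simp only [torusChar_apply_add, ← mul_assoc]
    rw [integral_const_mul, integral_orbitHaar_torusChar]
    simp
  · exact fun m => (hcont m).integrable_of_hasCompactSupport (HasCompactSupport.of_compactSpace _)
  · refine Summable.of_nonneg_of_le (fun m => integral_nonneg fun g => norm_nonneg _)
      (fun m => ?_) S.summable_coeffBound
    simp only [norm_mul, norm_torusChar, mul_one]
    simpa using S.norm_coeff_le m ξ

/-! ### The limit of one Fourier mode -/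

/-- The integral `∫ φ(t) e^{i t λ} dt`. -/
noncomputable def charIntegral (φ : ℝ → ℂ) (r : ℝ) : ℂ :=
  ∫ t, φ t * Complex.exp (((t * r : ℝ) : ℂ) * Complex.I)

lemma norm_charIntegral_le (φ : ℝ → ℂ) (r : ℝ) : ‖charIntegral φ r‖ ≤ ∫ t, ‖φ t‖ := by
  refine (norm_integral_le_integral_norm _).trans_eq ?_
  simp only [norm_mul, Complex.norm_exp_ofReal_mul_I, mul_one]

lemma continuous_charIntegral {φ : ℝ → ℂ} (hφ : Integrable φ) : Continuous (charIntegral φ) := by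
  unfold charIntegral
  refine continuous_of_dominated (bound := fun t => ‖φ t‖) (fun r => ?_)
    (fun r => .of_forall fun t => ?_) hφ.norm (.of_forall fun t => by fun_prop)
  · exact hφ.aestronglyMeasurable.mul (Continuous.aestronglyMeasurable (by fun_prop))
  · rw [norm_mul, Complex.norm_exp_ofReal_mul_I, mul_one]

lemma tendsto_charIntegral_cocompact (φ : ℝ → ℂ) :
    Tendsto (charIntegral φ) (cocompact ℝ) (𝓝 0) := by
  have h := Real.tendsto_integral_exp_smul_cocompact φ
  have h2 : Tendsto (fun r : ℝ => r * (-(2 * Real.pi)⁻¹)) (cocompact ℝ) (cocompact ℝ) :=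
    (Homeomorph.mulRight₀ (-(2 * Real.pi)⁻¹)
      (neg_ne_zero.2 (inv_ne_zero Real.two_pi_pos.ne'))).isClosedEmbedding.tendsto_cocompact
  refine (h.comp h2).congr fun r => ?_
  simp only [Function.comp_apply, charIntegral]
  refine integral_congr_ae (.of_forall fun t => ?_)
  simp only [Circle.smul_def, Real.fourierChar_apply, smul_eq_mul]
  rw [mul_comm]
  congr 4
  field_simp

lemma tendsto_of_tendsto_smul_sub {ι : Type*} {l : Filter ι} {τ : ι → ℝ} {q : ι → Space d}
    {ξ₀ η : Space d} (hτ : Tendsto τ l atTop)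
    (hq : Tendsto (fun i => τ i • (q i - ξ₀)) l (𝓝 η)) : Tendsto q l (𝓝 ξ₀) := by
  have h := (hτ.inv_tendsto_atTop.smul hq).add_const ξ₀
  rw [zero_smul, zero_add] at h
  refine h.congr' ?_
  filter_upwards [hτ.eventually_gt_atTop 0] with i hi
  simp [smul_smul, hi.ne']

/-- If `q → ξ₀` with `τ (q - ξ₀) → η` and `τ s → 0`, the difference quotients of `H` at step `s m`
deviate from `m · ∇H(ξ₀)` by `τ⁻¹ m · d²H(ξ₀) η` to leading order. -/
lemma tendsto_differenceQuotient {ι : Type*} {l : Filter ι} {H : Space d → ℝ}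
    (hH : ContDiff ℝ ∞ H) {τ s : ι → ℝ} {q : ι → Space d} {ξ₀ η m : Space d}
    (hτ : Tendsto τ l atTop) (hs : ∀ᶠ i in l, 0 < s i) (hτs : Tendsto (fun i => s i * τ i) l (𝓝 0))
    (hq : Tendsto (fun i => τ i • (q i - ξ₀)) l (𝓝 η)) :
    Tendsto (fun i => τ i / s i * (H (q i + s i • m) - H (q i)) -
      τ i * inner ℝ m (gradient H ξ₀)) l (𝓝 (inner ℝ m (hessian H ξ₀ η))) := by
  have hdiff : Differentiable ℝ H := hH.differentiable (by simp)
  have hmv : ∀ i, ∃ z ∈ segment ℝ (q i) (q i + s i • m),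
      H (q i + s i • m) - H (q i) = inner ℝ (gradient H z) (s i • m) := by
    intro i
    obtain ⟨z, hz, h⟩ := domain_mvt (f := H) (s := Set.univ) (x := q i) (y := q i + s i • m)
      (f' := fun z => fderiv ℝ H z)
      (fun x _ => (hdiff x).hasFDerivAt.hasFDerivWithinAt) convex_univ trivial trivial
    refine ⟨z, hz, ?_⟩
    rw [h, add_sub_cancel_left, ← toDual_gradient, InnerProductSpace.toDual_apply_apply]
  choose z hz hzH using hmv
  have hzq : Tendsto (fun i => τ i • (z i - q i)) l (𝓝 0) := by
    refine squeeze_zero_norm' (a := fun i => |s i * τ i| * ‖m‖) ?_ ?_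
    · refine .of_forall fun i => ?_
      obtain ⟨θ, ⟨hθ0, hθ1⟩, hθ⟩ := segment_eq_image' ℝ (q i) (q i + s i • m) ▸ hz i
      have : z i - q i = (θ * s i) • m := by
        rw [← hθ]
        simp [smul_smul]
      rw [this, smul_smul, norm_smul, Real.norm_eq_abs]
      refine mul_le_mul_of_nonneg_right ?_ (norm_nonneg m)
      rw [abs_mul, abs_mul, abs_mul, abs_of_nonneg hθ0]
      nlinarith [mul_nonneg (abs_nonneg (s i)) (abs_nonneg (τ i))]
    · simpa using hτs.abs.mul_const ‖m‖
  have hz0 : Tendsto (fun i => τ i • (z i - ξ₀)) l (𝓝 η) := by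
    have := hzq.add hq
    rw [zero_add] at this
    refine this.congr fun i => ?_
    rw [← smul_add, sub_add_sub_cancel]
  have hgrad : DifferentiableAt ℝ (gradient H) ξ₀ := by
    have h1 : ContDiff ℝ 1 (fderiv ℝ H) := hH.fderiv_right (by norm_cast)
    have h2 : ContDiff ℝ 1 (gradient H) :=
      (InnerProductSpace.toDual ℝ (Space d)).symm.contDiff.comp h1
    exact (h2.differentiable (by simp)) ξ₀
  have hlim := (hgrad.hasFDerivAt.hasFDerivWithinAt (s := Set.univ)).lim
    (c := τ) (d := fun i => z i - ξ₀)
    (by simpa using (tendsto_of_tendsto_smul_sub hτ hz0).sub_const ξ₀) (by simp) hz0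
  simp only [add_sub_cancel] at hlim
  have hinner := Tendsto.inner (𝕜 := ℝ) (tendsto_const_nhds (x := m)) hlim
  refine hinner.congr' ?_
  filter_upwards [hs] with i hi
  rw [hzH, inner_smul_right, inner_smul_right, inner_sub_right, real_inner_comm m]
  field_simp

/-- The lattice point whose cell, in the lattice of mesh `δ` centred at `δ ζ`, contains `x`. -/
noncomputable def sampleIndex (ζ : Space d) (δ : ℝ) (x : Space d) : Fin d → ℤ :=
  floorVec (δ⁻¹ • x + ζ)

lemma norm_sub_sample_le {δ : ℝ} (hδ : 0 < δ) (ζ x : Space d) :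
    ‖x - δ • (intVec (sampleIndex ζ δ x) - ζ)‖ ≤ δ * √d := by
  have h : x - δ • (intVec (sampleIndex ζ δ x) - ζ) =
      δ • (δ⁻¹ • x + ζ - intVec (floorVec (δ⁻¹ • x + ζ))) := by
    simp only [sampleIndex, smul_sub, smul_add, smul_smul, mul_inv_cancel₀ hδ.ne', one_smul]
    abel
  rw [h, norm_smul, Real.norm_of_nonneg hδ.le]
  exact mul_le_mul_of_nonneg_left (norm_sub_floorVec_le _) hδ.le

section Sampling

variable {τ δ : ℝ → ℝ} (hδ : ∀ h : ℝ, 0 < h → 0 < δ h)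
  (hδ_zero : Tendsto δ (𝓝[>] (0 : ℝ)) (𝓝 0))

include hδ hδ_zero

lemma tendsto_sample_position (ζ : ℝ → Space d) (x : Space d) :
    Tendsto (fun h => δ h • (intVec (sampleIndex (ζ h) (δ h) x) - ζ h)) (𝓝[>] (0 : ℝ)) (𝓝 x) := by
  rw [tendsto_iff_norm_sub_tendsto_zero]
  refine squeeze_zero' (.of_forall fun h => norm_nonneg _)
    (eventually_nhdsWithin_of_forall fun h hh => ?_) (g := fun h => δ h * √d) ?_
  · rw [norm_sub_rev]
    exact norm_sub_sample_le (hδ h hh) _ _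
  · simpa using hδ_zero.mul_const √d

lemma tendsto_sample_frequency (hτ : ∀ h : ℝ, 0 < h → 0 < τ h)
    (hhτδ : Tendsto (fun h => h * τ h / δ h) (𝓝[>] (0 : ℝ)) (𝓝 0))
    (ξ₀ η₀ x : Space d) :
    Tendsto (fun h => τ h • (h • intVec (sampleIndex (packetFrequency ξ₀ η₀ h (τ h)) (δ h) x) - ξ₀))
      (𝓝[>] (0 : ℝ)) (𝓝 η₀) := by
  have h1 := (hhτδ.smul (tendsto_sample_position hδ hδ_zero
    (fun h => packetFrequency ξ₀ η₀ h (τ h)) x)).add_const η₀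
  rw [zero_smul, zero_add] at h1
  refine h1.congr' ?_
  filter_upwards [self_mem_nhdsWithin] with h hh
  have hh' : h ≠ 0 := (Set.mem_Ioi.1 hh).ne'
  have hδ' := (hδ h hh).ne'
  have hτ' := (hτ h hh).ne'
  have e1 : (h * τ h) • packetFrequency ξ₀ η₀ h (τ h) = τ h • ξ₀ + η₀ := by
    rw [packetFrequency, smul_add, smul_smul, smul_smul, mul_inv_cancel₀ (mul_ne_zero hh' hτ'),
      one_smul]
    congr 2
    field_simp
  rw [smul_smul, div_mul_cancel₀ _ hδ', smul_sub, e1, smul_sub, smul_smul, mul_comm h]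
  abel

end Sampling

/-- The contribution to the time-averaged Wigner distribution of the interference between the modes
`k + m` and `k`. -/
noncomputable def beatTerm {a : Phase d → ℂ} (S : SymbolExpansion a) (H : Space d → ℝ)
    (φ : ℝ → ℂ) (g : Space d → ℂ) (x₀ ξ₀ η₀ : Space d) (h τ δ : ℝ) (m k : Fin d → ℤ) : ℂ :=
  charIntegral φ (beatFrequency H h τ m k) *
    beatAmplitude S g x₀ (packetFrequency ξ₀ η₀ h τ) δ h m k

/-- The limit as `h → 0⁺` of the contribution of the `m`-th Fourier mode of the symbol. -/
noncomputable def limitTerm {a : Phase d → ℂ} (S : SymbolExpansion a) (H : Space d → ℝ)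
    (φ : ℝ → ℂ) (x₀ ξ₀ η₀ : Space d) (m : Fin d → ℤ) : ℂ :=
  if inner ℝ (intVec m) (gradient H ξ₀) = 0 then
    charIntegral φ (inner ℝ (intVec m) (hessian H ξ₀ η₀)) *
      (torusChar m (toTorus x₀) * S.coeff m ξ₀)
  else 0

section Limit

variable {a : Phase d → ℂ} (S : SymbolExpansion a) {H : Space d → ℝ} (hH : ContDiff ℝ ∞ H)
  {τ δ : ℝ → ℝ} (hτ : ∀ h : ℝ, 0 < h → 0 < τ h) (hδ : ∀ h : ℝ, 0 < h → 0 < δ h)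
  (hτ_top : Tendsto τ (𝓝[>] (0 : ℝ)) atTop)
  (hhτ : Tendsto (fun h : ℝ => h * τ h) (𝓝[>] (0 : ℝ)) (𝓝 0))
  (hδ_zero : Tendsto δ (𝓝[>] (0 : ℝ)) (𝓝 0))
  (hhτδ : Tendsto (fun h => h * τ h / δ h) (𝓝[>] (0 : ℝ)) (𝓝 0))
  {φ : ℝ → ℂ} (hφ : Integrable φ) {g : Space d → ℂ} (hg : Continuous g)
  (x₀ ξ₀ η₀ : Space d) (m : Fin d → ℤ)

include hH hτ hδ hτ_top hhτ hδ_zero hhτδ hφ in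
/-- At frequencies resonant with `∇H(ξ₀)` the beat frequency converges to `m · d²H(ξ₀) η₀`; at the
other ones it diverges, and the Riemann-Lebesgue lemma applies. -/
lemma tendsto_charIntegral_beatFrequency (x : Space d) :
    Tendsto (fun h => charIntegral φ (beatFrequency H h (τ h) m
        (sampleIndex (packetFrequency ξ₀ η₀ h (τ h)) (δ h) x))) (𝓝[>] (0 : ℝ))
      (𝓝 (if inner ℝ (intVec m) (gradient H ξ₀) = 0 then
        charIntegral φ (inner ℝ (intVec m) (hessian H ξ₀ η₀)) else 0)) := by
  have hq := tendsto_sample_frequency hδ hδ_zero hτ hhτδ ξ₀ η₀ x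
  have hd := tendsto_differenceQuotient hH (m := intVec m) hτ_top
    (eventually_mem_nhdsWithin (a := (0 : ℝ)) (s := Set.Ioi 0)) hhτ hq
  have hbeat : ∀ h k, beatFrequency H h (τ h) m k =
      τ h / h * (H (h • intVec k + h • intVec m) - H (h • intVec k)) := by
    intro h k
    rw [beatFrequency, intVec_add, smul_add]
  simp only [← hbeat] at hd
  set c := inner ℝ (intVec m) (gradient H ξ₀) with hc
  split_ifs with h0
  · simp only [h0, mul_zero, sub_zero] at hd
    exact ((continuous_charIntegral hφ).tendsto _).comp hd
  · refine (tendsto_charIntegral_cocompact φ).comp ?_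
    rcases lt_or_gt_of_ne h0 with hneg | hpos
    · refine Tendsto.mono_right ?_ atBot_le_cocompact
      refine ((hτ_top.atTop_mul_const_of_neg hneg).atBot_add hd).congr fun h => ?_
      ring
    · refine Tendsto.mono_right ?_ atTop_le_cocompact
      refine ((hτ_top.atTop_mul_const hpos).atTop_add hd).congr fun h => ?_
      ring

include hH hτ hδ hτ_top hhτ hδ_zero hhτδ hφ hg in
lemma tendsto_beatTerm (x : Space d) :
    Tendsto (fun h => beatTerm S H φ g x₀ ξ₀ η₀ h (τ h) (δ h) m
        (sampleIndex (packetFrequency ξ₀ η₀ h (τ h)) (δ h) x)) (𝓝[>] (0 : ℝ))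
      (𝓝 (limitTerm S H φ x₀ ξ₀ η₀ m * ((starRingEnd ℂ) (g x) * g x))) := by
  have h1 := tendsto_charIntegral_beatFrequency hH hτ hδ hτ_top hhτ hδ_zero hhτδ hφ ξ₀ η₀ m x
  have hpos := tendsto_sample_position hδ hδ_zero (fun h => packetFrequency ξ₀ η₀ h (τ h)) x
  have h0 : Tendsto (fun h : ℝ => h) (𝓝[>] (0 : ℝ)) (𝓝 0) := nhdsWithin_le_nhds
  have hfreq := tendsto_of_tendsto_smul_sub hτ_top
    (tendsto_sample_frequency hδ hδ_zero hτ hhτδ ξ₀ η₀ x)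
  have h2 := (hg.tendsto x).comp hpos
  have hpos' : Tendsto (fun h => δ h • (intVec
      (sampleIndex (packetFrequency ξ₀ η₀ h (τ h)) (δ h) x + m) -
      packetFrequency ξ₀ η₀ h (τ h))) (𝓝[>] (0 : ℝ)) (𝓝 x) := by
    have h3 := hpos.add (hδ_zero.smul_const (intVec m))
    rw [zero_smul, add_zero] at h3
    refine h3.congr fun h => ?_
    rw [intVec_add, ← smul_add]
    congr 1
    abel
  have h3 := (Complex.continuous_conj.tendsto _).comp ((hg.tendsto x).comp hpos')
  have harg : Tendsto (fun h => h • (intVec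
      (sampleIndex (packetFrequency ξ₀ η₀ h (τ h)) (δ h) x) + (2⁻¹ : ℝ) • intVec m))
      (𝓝[>] (0 : ℝ)) (𝓝 ξ₀) := by
    have h4 := hfreq.add (h0.smul_const ((2⁻¹ : ℝ) • intVec m))
    rw [zero_smul, add_zero] at h4
    exact h4.congr fun h => (smul_add _ _ _).symm
  have h4 := ((S.continuous_coeff m).tendsto ξ₀).comp harg
  have h5 := h1.mul (((h3.mul h2).const_mul (torusChar m (toTorus x₀))).mul h4)
  have e : limitTerm S H φ x₀ ξ₀ η₀ m * ((starRingEnd ℂ) (g x) * g x) =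
      (if inner ℝ (intVec m) (gradient H ξ₀) = 0 then
        charIntegral φ (inner ℝ (intVec m) (hessian H ξ₀ η₀)) else 0) *
      (torusChar m (toTorus x₀) * ((starRingEnd ℂ) (g x) * g x) * S.coeff m ξ₀) := by
    rw [limitTerm]
    split_ifs <;> ring
  rw [e]
  exact h5

lemma norm_beatAmplitude_le {M : ℝ} (hM : ∀ x, ‖g x‖ ≤ M) (ζ : Space d) (r h : ℝ)
    (k : Fin d → ℤ) :
    ‖beatAmplitude S g x₀ ζ r h m k‖ ≤ M * M * S.coeffBound m := by
  have hM0 : 0 ≤ M := (norm_nonneg _).trans (hM 0)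
  rw [beatAmplitude, norm_mul, norm_mul, norm_torusChar, one_mul, norm_mul, RCLike.norm_conj]
  exact mul_le_mul (mul_le_mul (hM _) (hM _) (norm_nonneg _) hM0) (S.norm_coeff_le _ _)
    (norm_nonneg _) (mul_nonneg hM0 hM0)

/-- The sampled terms are dominated, uniformly in the mesh, by a multiple of the indicator function
of a ball. -/
lemma norm_beatTerm_le {M R : ℝ} (hM : ∀ x, ‖g x‖ ≤ M) (hR : ∀ x, g x ≠ 0 → ‖x‖ ≤ R)
    (H : Space d → ℝ) (φ : ℝ → ℂ) {h τ δ : ℝ} (hδ : 0 < δ) (hδ1 : δ ≤ 1) (x : Space d) :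
    ‖beatTerm S H φ g x₀ ξ₀ η₀ h τ δ m (sampleIndex (packetFrequency ξ₀ η₀ h τ) δ x)‖ ≤
      (Metric.closedBall (0 : Space d) (R + √d)).indicator
        (fun _ => (∫ t, ‖φ t‖) * (M * M * S.coeffBound m)) x := by
  by_cases hx : x ∈ Metric.closedBall (0 : Space d) (R + √d)
  · rw [Set.indicator_of_mem hx, beatTerm, norm_mul]
    exact mul_le_mul (norm_charIntegral_le φ _) (norm_beatAmplitude_le S x₀ m hM _ _ _ _)
      (norm_nonneg _) (integral_nonneg fun t => norm_nonneg _)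
  · rw [Set.indicator_of_notMem hx]
    have h0 : g (δ • (intVec (sampleIndex (packetFrequency ξ₀ η₀ h τ) δ x) -
        packetFrequency ξ₀ η₀ h τ)) = 0 := by
      by_contra hne
      refine hx ?_
      have h1 := hR _ hne
      have h2 := norm_sub_sample_le hδ (packetFrequency ξ₀ η₀ h τ) x
      have h3 := norm_le_norm_sub_add x (δ • (intVec (sampleIndex (packetFrequency ξ₀ η₀ h τ) δ x) -
        packetFrequency ξ₀ η₀ h τ))
      have h4 : δ * √d ≤ √d := mul_le_of_le_one_left (Real.sqrt_nonneg _) hδ1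
      rw [mem_closedBall_zero_iff]
      linarith
    simp [beatTerm, beatAmplitude, h0]

include hH hτ hδ hτ_top hhτ hδ_zero hhτδ hφ hg in
/-- Riemann sums: the rescaled lattice sums of the interference terms converge, and so does their
series over the Fourier modes of the symbol. -/
lemma tendsto_tsum_integral_beatTerm (hgc : HasCompactSupport g) (hg1 : ∫ x, ‖g x‖ ^ 2 = 1) :
    Tendsto (fun h => ∑' m, ∫ x, beatTerm S H φ g x₀ ξ₀ η₀ h (τ h) (δ h) m
        (sampleIndex (packetFrequency ξ₀ η₀ h (τ h)) (δ h) x)) (𝓝[>] (0 : ℝ))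
      (𝓝 (∑' m, limitTerm S H φ x₀ ξ₀ η₀ m)) := by
  obtain ⟨M, hM⟩ := hgc.exists_bound_of_continuous hg
  obtain ⟨R, hR'⟩ := hgc.isBounded.exists_norm_le
  have hR : ∀ x, g x ≠ 0 → ‖x‖ ≤ R := fun x hx => hR' x (subset_tsupport _ hx)
  have hδ1 : ∀ᶠ h in 𝓝[>] (0 : ℝ), δ h ≤ 1 := hδ_zero.eventually_le_const one_pos
  set Φ := ∫ t, ‖φ t‖ with hΦ
  have hbint : ∀ m, Integrable ((Metric.closedBall (0 : Space d) (R + √d)).indicator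
        (fun _ => Φ * (M * M * S.coeffBound m))) := by
    intro m
    rw [integrable_indicator_iff measurableSet_closedBall]
    exact integrableOn_const (by exact measure_closedBall_lt_top.ne)
  refine tendsto_tsum_of_dominated_convergence (bound := fun m =>
      volume.real (Metric.closedBall (0 : Space d) (R + √d)) * (Φ * (M * M * S.coeffBound m)))
    (((S.summable_coeffBound.mul_left _).mul_left _).mul_left _) (fun m => ?_) ?_
  · have hlim := tendsto_integral_filter_of_dominated_convergence
      (μ := (volume : Measure (Space d))) (l := 𝓝[>] (0 : ℝ))
      (F := fun h x => beatTerm S H φ g x₀ ξ₀ η₀ h (τ h) (δ h) m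
        (sampleIndex (packetFrequency ξ₀ η₀ h (τ h)) (δ h) x)) _
      (.of_forall fun h => ?_) ?_ (hbint m) (.of_forall fun x =>
        tendsto_beatTerm S hH hτ hδ hτ_top hhτ hδ_zero hhτδ hφ hg x₀ ξ₀ η₀ m x)
    · have e : ∫ x, limitTerm S H φ x₀ ξ₀ η₀ m * ((starRingEnd ℂ) (g x) * g x) =
          limitTerm S H φ x₀ ξ₀ η₀ m := by
        have e1 : ∀ x, (starRingEnd ℂ) (g x) * g x = ((‖g x‖ ^ 2 : ℝ) : ℂ) := by
          intro x
          rw [Complex.conj_mul', Complex.ofReal_pow]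
        simp only [e1]
        rw [integral_const_mul, integral_complex_ofReal, hg1, Complex.ofReal_one, mul_one]
      rwa [e] at hlim
    · have hmeas : Measurable fun x : Space d =>
          sampleIndex (packetFrequency ξ₀ η₀ h (τ h)) (δ h) x :=
        measurable_floorVec.comp (by fun_prop)
      exact ((measurable_of_countable (beatTerm S H φ g x₀ ξ₀ η₀ h (τ h) (δ h) m)).comp
        hmeas).aestronglyMeasurable
    · filter_upwards [hδ1, self_mem_nhdsWithin] with h h1 hh
      exact .of_forall fun x => norm_beatTerm_le S x₀ ξ₀ η₀ m hM hR H φ (hδ h hh) h1 x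
  · filter_upwards [hδ1, self_mem_nhdsWithin] with h h1 hh m
    refine (norm_integral_le_of_norm_le (hbint m) (.of_forall fun x =>
      norm_beatTerm_le S x₀ ξ₀ η₀ m hM hR H φ (hδ h hh) h1 x)).trans_eq ?_
    rw [integral_indicator measurableSet_closedBall, setIntegral_const, smul_eq_mul]

end Limit

/-! ### Weak-* convergence -/

lemma integral_mul_sum_exp {φ : ℝ → ℂ} (hφ : Integrable φ) {ι : Type*} (F : Finset ι)
    (r : ι → ℝ) (b : ι → ℂ) (C : ℂ) :
    ∫ t, φ t * (C * ∑ k ∈ F, Complex.exp (((t * r k : ℝ) : ℂ) * Complex.I) * b k) =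
      C * ∑ k ∈ F, charIntegral φ (r k) * b k := by
  have h : ∀ t, φ t * (C * ∑ k ∈ F, Complex.exp (((t * r k : ℝ) : ℂ) * Complex.I) * b k) =
      ∑ k ∈ F, (φ t * Complex.exp (((t * r k : ℝ) : ℂ) * Complex.I)) * (C * b k) := by
    intro t
    rw [Finset.mul_sum, Finset.mul_sum]
    exact Finset.sum_congr rfl fun k _ => by ring
  simp only [h]
  rw [integral_finsetSum, Finset.mul_sum]
  · refine Finset.sum_congr rfl fun k _ => ?_
    rw [integral_mul_const, charIntegral]
    ring
  · intro k _
    refine Integrable.mul_const ?_ _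
    refine hφ.norm.mono' (hφ.aestronglyMeasurable.mul
      (Continuous.aestronglyMeasurable (by fun_prop))) (.of_forall fun t => ?_)
    rw [norm_mul, Complex.norm_exp_ofReal_mul_I, mul_one]

/-- Integration in time of a uniformly convergent series. -/
lemma hasSum_integral_mul {φ : ℝ → ℂ} (hφ : Integrable φ) {ι : Type*} [Countable ι]
    {f : ι → ℝ → ℂ} (hf : ∀ m, Continuous (f m)) {b : ι → ℝ} (hb : Summable b)
    (hfb : ∀ m t, ‖f m t‖ ≤ b m) {G : ℝ → ℂ} (hG : ∀ t, HasSum (fun m => f m t) (G t)) :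
    HasSum (fun m => ∫ t, φ t * f m t) (∫ t, φ t * G t) := by
  have hbound : ∀ m t, ‖φ t * f m t‖ ≤ ‖φ t‖ * b m := by
    intro m t
    rw [norm_mul]
    exact mul_le_mul_of_nonneg_left (hfb m t) (norm_nonneg _)
  have h := hasSum_integral_of_summable_integral_norm (μ := (volume : Measure ℝ))
    (F := fun m t => φ t * f m t)
    (fun m => (hφ.norm.mul_const (b m)).mono'
      (hφ.aestronglyMeasurable.mul (hf m).aestronglyMeasurable) (.of_forall (hbound m)))
    (Summable.of_nonneg_of_le (fun m => integral_nonneg fun t => norm_nonneg _) (fun m => by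
      refine (integral_mono_of_nonneg (.of_forall fun t => norm_nonneg _)
        (hφ.norm.mul_const (b m)) (.of_forall (hbound m))).trans_eq ?_
      exact integral_mul_const _ _) (hb.mul_left (∫ t, ‖φ t‖)))
  have e : ∀ t, ∑' m, φ t * f m t = φ t * G t := fun t => by
    rw [tsum_mul_left, (hG t).tsum_eq]
  simpa only [e] using h

/-- A uniformly convergent series of bounded continuous functions of time is bounded and
measurable. -/
lemma memLp_top_of_hasSum {ι : Type*} {f : ι → ℝ → ℂ} (hf : ∀ m, Continuous (f m)) {b : ι → ℝ}
    (hb : Summable b) (hfb : ∀ m t, ‖f m t‖ ≤ b m) {G : ℝ → ℂ}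
    (hG : ∀ t, HasSum (fun m => f m t) (G t)) : MemLp G ∞ volume := by
  have e : G = fun t => ∑' m, f m t := funext fun t => (hG t).tsum_eq.symm
  refine memLp_top_of_bound (C := ∑' m, b m) ?_ (.of_forall fun t => ?_)
  · rw [e]
    exact (continuous_tsum hf hb hfb).aestronglyMeasurable
  · rw [← (hG t).tsum_eq]
    exact tsum_of_norm_bounded hb.hasSum fun m => hfb m t

end TorusSemiclassical

theorem mainTheorem12 (d : ℕ) (H : Space d → ℝ) (hH : ContDiff ℝ ∞ H)
    (τ ε : ℝ → ℝ) (hτ : ∀ h : ℝ, 0 < h → 0 < τ h) (hε : ∀ h : ℝ, 0 < h → 0 < ε h)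
    (hτ_top : Tendsto τ (𝓝[>] (0 : ℝ)) atTop)
    (hhτ : Tendsto (fun h : ℝ => h * τ h) (𝓝[>] (0 : ℝ)) (𝓝 0))
    (hε_zero : Tendsto ε (𝓝[>] (0 : ℝ)) (𝓝 0))
    (hhτε : (fun h : ℝ => h * τ h) =o[𝓝[>] (0 : ℝ)] ε)
    (ρ : 𝓢(Space d, ℂ)) (hρ_norm : ∫ x, ‖ρ x‖ ^ 2 = 1)
    (hρ_supp : HasCompactSupport (fun ξ : Space d => (𝓕 (fun x => ρ x) : Space d → ℂ) ξ))
    (x₀ ξ₀ η₀ : Space d) (hdef : HessianDefinite H ξ₀) (hη₀ : η₀ ∈ resonantSpan H ξ₀) :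
    ∃ μ : ℝ → Measure (Phase d),
      (∀ t : ℝ, IsUniformOrbitMeasure H (x₀ + t • hessian H ξ₀ η₀) ξ₀ (μ t)) ∧
      TendstoWeakStar
        (fun h t => wigner h
          (propagator H h (τ h * t)
            (periodize (modulatedPacket (fun x => ρ x) x₀ ξ₀ η₀ h (τ h) (ε h)))))
        μ := by
  refine ⟨fun t => orbitMeasure (gradient H ξ₀) (x₀ + t • hessian H ξ₀ η₀) ξ₀,
    fun t => isUniformOrbitMeasure_orbitMeasure H _ ξ₀, fun a ha => ?_⟩
  obtain ⟨S⟩ := ha.exists_symbolExpansion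
  set g : Space d → ℂ := DFunLike.coe (𝓕 ρ : 𝓢(Space d, ℂ)) with hg
  have hgc : HasCompactSupport g := hρ_supp
  have hgcont : Continuous g := (𝓕 ρ : 𝓢(Space d, ℂ)).continuous
  have hg1 : ∫ x, ‖g x‖ ^ 2 = 1 := (SchwartzMap.integral_norm_sq_fourier ρ).trans hρ_norm
  obtain ⟨M, hM⟩ := hgc.exists_bound_of_continuous hgcont
  set δ : ℝ → ℝ := fun h => ε h / (2 * Real.pi) with hδ_def
  have hδ : ∀ h : ℝ, 0 < h → 0 < δ h := fun h hh => div_pos (hε h hh) Real.two_pi_pos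
  have hδ_zero : Tendsto δ (𝓝[>] (0 : ℝ)) (𝓝 0) := by
    simpa using hε_zero.div_const (2 * Real.pi)
  have hhτδ : Tendsto (fun h => h * τ h / δ h) (𝓝[>] (0 : ℝ)) (𝓝 0) := by
    have := hhτε.tendsto_div_nhds_zero.mul_const (2 * Real.pi)
    rw [zero_mul] at this
    refine this.congr fun h => ?_
    simp only [hδ_def]
    rw [div_div_eq_mul_div]
    ring
  -- finitely many frequencies carry the packet at a given `h`
  have hF : ∀ h : ℝ, ∃ F : Finset (Fin d → ℤ), 0 < h →
      ∀ k ∉ F, g (δ h • (intVec k - packetFrequency ξ₀ η₀ h (τ h))) = 0 := by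
    intro h
    by_cases hh : 0 < h
    · obtain ⟨F, hF⟩ := exists_finset_fourier_eq_zero hgc (hδ h hh)
        (packetFrequency ξ₀ η₀ h (τ h))
      exact ⟨F, fun _ => hF⟩
    · exact ⟨∅, fun h' => absurd h' hh⟩
  choose F hF using hF
  set f : ℝ → (Fin d → ℤ) → ℝ → ℂ := fun h m t => ((δ h ^ d : ℝ) : ℂ) * ∑ k ∈ F h,
        Complex.exp (((t * beatFrequency H h (τ h) m k : ℝ) : ℂ) * Complex.I) *
        beatAmplitude S g x₀ (packetFrequency ξ₀ η₀ h (τ h)) (δ h) h m k with hf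
  have hsum : ∀ h, 0 < h → ∀ t, HasSum (fun m => f h m t) (wigner h (propagator H h (τ h * t)
      (periodize (modulatedPacket (fun x => ρ x) x₀ ξ₀ η₀ h (τ h) (ε h)))) a) :=
    fun h hh t => hasSum_wigner_propagator S H ρ x₀ ξ₀ η₀ hh (hε h hh) (F h) (hF h hh) t
  have hfc : ∀ h m, Continuous (f h m) := fun h m => by simp only [hf]; fun_prop
  have hfb : ∀ h, 0 < h → ∀ m t,
      ‖f h m t‖ ≤ δ h ^ d * ∑ _k ∈ F h, M * M * S.coeffBound m := by
    intro h hh m t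
    simp only [hf]
    rw [norm_mul, Complex.norm_real, Real.norm_of_nonneg (pow_pos (hδ h hh) d).le]
    refine mul_le_mul_of_nonneg_left (norm_sum_le_of_le _ fun k _ => ?_) (pow_pos (hδ h hh) d).le
    rw [norm_mul, Complex.norm_exp_ofReal_mul_I, one_mul]
    exact norm_beatAmplitude_le S x₀ m hM _ _ _ k
  have hbs : ∀ h, Summable fun m => δ h ^ d * ∑ _k ∈ F h, M * M * S.coeffBound m := fun h =>
    (summable_sum fun _ _ => S.summable_coeffBound.mul_left (M * M)).mul_left _
  -- the expansion of the limit
  set f₀ : (Fin d → ℤ) → ℝ → ℂ := fun m t =>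
    if inner ℝ (intVec m) (gradient H ξ₀) = 0 then
      S.coeff m ξ₀ * torusChar m (toTorus (x₀ + t • hessian H ξ₀ η₀)) else 0 with hf₀
  have hsum₀ : ∀ t, HasSum (fun m => f₀ m t)
      (∫ z, a z ∂(orbitMeasure (gradient H ξ₀) (x₀ + t • hessian H ξ₀ η₀) ξ₀)) := fun t =>
    S.hasSum_integral_orbitMeasure ha.continuous _ _ _
  have hf₀c : ∀ m, Continuous (f₀ m) := by
    intro m
    simp only [hf₀]
    split_ifs
    · have : Continuous fun t : ℝ => toTorus (x₀ + t • hessian H ξ₀ η₀) :=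
        continuous_toTorus.comp (by fun_prop)
      fun_prop
    · exact continuous_const
  have hf₀b : ∀ m t, ‖f₀ m t‖ ≤ S.coeffBound m := by
    intro m t
    simp only [hf₀]
    split_ifs
    · rw [norm_mul, norm_torusChar, mul_one]
      exact S.norm_coeff_le m ξ₀
    · simpa using S.coeffBound_nonneg m
  refine ⟨fun h hh => memLp_top_of_hasSum (hfc h) (hbs h) (hfb h hh) (hsum h hh),
    memLp_top_of_hasSum hf₀c S.summable_coeffBound hf₀b hsum₀, fun φ hφ => ?_⟩
  have hlim := tendsto_tsum_integral_beatTerm S hH hτ hδ hτ_top hhτ hδ_zero hhτδ hφ hgcont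
    x₀ ξ₀ η₀ hgc hg1
  have hright : ∫ t, φ t * ∫ z, a z ∂(orbitMeasure (gradient H ξ₀)
      (x₀ + t • hessian H ξ₀ η₀) ξ₀) = ∑' m, limitTerm S H φ x₀ ξ₀ η₀ m := by
    rw [← (hasSum_integral_mul hφ hf₀c S.summable_coeffBound hf₀b hsum₀).tsum_eq]
    refine tsum_congr fun m => ?_
    simp only [hf₀, limitTerm]
    split_ifs
    · rw [charIntegral, ← integral_mul_const]
      refine integral_congr_ae (.of_forall fun t => ?_)
      simp only
      rw [toTorus_add, torusChar_apply_add, torusChar_toTorus m (t • _), inner_smul_right,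
        mul_comm Complex.I]
      ring
    · simp
  rw [hright]
  refine hlim.congr' ?_
  filter_upwards [self_mem_nhdsWithin] with h hh
  rw [← (hasSum_integral_mul hφ (hfc h) (hbs h) (hfb h hh) (hsum h hh)).tsum_eq]
  refine tsum_congr fun m => ?_
  simp only [hf]
  rw [integral_mul_sum_exp hφ]
  refine (sum_eq_integral_floorVec (hδ h hh) (packetFrequency ξ₀ η₀ h (τ h)) (F h)
    (beatTerm S H φ g x₀ ξ₀ η₀ h (τ h) (δ h) m) fun k hk => ?_).symm
  simp [beatTerm, beatAmplitude, hF h hh k hk]
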